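/- All Lie algebras are over a fixed field $F$. For an ideal $N$ of a Lie algebra $L$ (a \emph{pair} $(L,N)$), the nonabelian tensor product $L\otimes N$ is the Lie algebra generated by symbols $l\otimes n$ ($l\in L$, $n\in N$) subject to \[c(l\otimes n)=cl\otimes n=l\otimes cn,\quad (l+l')\otimes n=l\otimes n+l'\otimes n,\quad l\otimes(n+n')=l\otimes n+l\otimes n',\] \[[l,l']\otimes n=l\otimes[l',n]-l'\otimes[l,n],\quad l\otimes[n,n']=[n',l]\otimes n-[n,l]\otimes n',\quad [l\otimes n,l'\otimes n']=-[n,l]\otimes[l',n'].\] Let $\kappa_{L,N}:L\otimes N\to [L,N]$, $l\otimes n\mapsto[l,n]$, and $J_2(L,N)=\ker\kappa_{L,N}$. Let $L\,\square\,N$ (the diagonal ideal) be the ideal of $L\otimes N$ generated by all $n\otimes n$ with $n\in N$, let $L\wedge N=(L\otimes N)/(L\,\square\,N)$, and let the Schur multiplier $M(L,N)$ of the pair be the kernel of the induced map $\kappa'_{L,N}:L\wedge N\to[L,N]$, $l\wedge n\mapsto [l,n]$. Write $L_1*L_2$ for the free product (coproduct) of Lie algebras. \textbf{Theorem.} Let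 $N_1$ and $N_2$ be ideals of finite-dimensional Lie algebras $L_1$ and $L_2$ over $F$ such that $(L_1*L_2,\,N_1*N_2)$ is a pair, i.e. such that $N_1*N_2$ (regarded as a subalgebra of $L_1*L_2$ through the natural map) is an ideal of $L_1*L_2$. Then there are isomorphisms of Lie algebras: \begin{itemize} \item[(i)] $J_2(L_1*L_2,\,N_1*N_2)\simeq J_2(L_1,N_1)\oplus J_2(L_2,N_2)\oplus\left(\dfrac{N_1}{[N_1,L_1]}\otimes\dfrac{N_2}{[N_2,L_2]}\right)$, where the last summand is the tensor product of abelian Lie algebras acting trivially on each other; \item[(ii)] $(L_1*L_2)\,\square\,(N_1*N_2)\simeq(L_1\oplus L_2)\,\square\,(N_1\oplus N_2)$; \item[(iii)] $M(L_1*L_2,\,N_1*N_2)\simeq M(L_1,N_1)\oplus M(L_2,N_2)$, whenever $N_1$ has a complement in $L_1$ (a subalgebra $K$ with $L_1=N_1\oplus K$ as vector spaces) and $[N_1,L_1]=[L_1,L_1]$. \end{itemize} -/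

import Mathlib

noncomputable section

namespace LiePair

universe u v w z

section Quotient

variable {F : Type u} {L : Type v} {M : Type w} [Field F] [LieRing L] [LieAlgebra F L]
  [LieRing M] [LieAlgebra F M]

/-- The projection onto the quotient by an ideal, as a morphism of Lie algebras. -/
def quotMk (I : LieIdeal F L) : L →ₗ⁅F⁆ L ⧸ I :=
  { (LieSubmodule.Quotient.mk' I : L →ₗ[F] L ⧸ I) with
    map_lie' := fun {x y} => LieSubmodule.Quotient.mk_bracket I x y }

/-- A morphism of Lie algebras that kills an ideal descends to the quotient. -/
def quotLift (I : LieIdeal F L) (f : L →ₗ⁅F⁆ M) (h : I ≤ f.ker) : L ⧸ I →ₗ⁅F⁆ M :=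
  { I.toSubmodule.liftQ (f : L →ₗ[F] M) (fun x hx => by
      have := h hx
      rw [LieHom.mem_ker] at this
      simpa using this) with
    map_lie' := fun {x y} => by
      induction x using Submodule.Quotient.induction_on
      induction y using Submodule.Quotient.induction_on
      exact f.map_lie _ _ }

theorem quotLift_mk (I : LieIdeal F L) (f : L →ₗ⁅F⁆ M) (h : I ≤ f.ker) (x : L) :
    quotLift I f h (quotMk I x) = f x := rfl

end Quotient

section FreeProduct

variable (F : Type u) (L₁ : Type v) (L₂ : Type w) [Field F] [LieRing L₁] [LieAlgebra F L₁]
  [LieRing L₂] [LieAlgebra F L₂]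

/-- The relators saying that the two maps `L₁ → L₁ * L₂` and `L₂ → L₁ * L₂` are morphisms of
Lie algebras. -/
inductive FreeProdRelator : FreeLieAlgebra F (L₁ ⊕ L₂) → Prop
  | add_left (x y : L₁) : FreeProdRelator
      (FreeLieAlgebra.of F (Sum.inl (x + y)) -
        (FreeLieAlgebra.of F (Sum.inl x) + FreeLieAlgebra.of F (Sum.inl y)))
  | smul_left (c : F) (x : L₁) : FreeProdRelator
      (FreeLieAlgebra.of F (Sum.inl (c • x)) - c • FreeLieAlgebra.of F (Sum.inl x))
  | lie_left (x y : L₁) : FreeProdRelator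
      (FreeLieAlgebra.of F (Sum.inl ⁅x, y⁆) -
        ⁅FreeLieAlgebra.of F (Sum.inl x : L₁ ⊕ L₂), FreeLieAlgebra.of F (Sum.inl y : L₁ ⊕ L₂)⁆)
  | add_right (x y : L₂) : FreeProdRelator
      (FreeLieAlgebra.of F (Sum.inr (x + y)) -
        (FreeLieAlgebra.of F (Sum.inr x) + FreeLieAlgebra.of F (Sum.inr y)))
  | smul_right (c : F) (x : L₂) : FreeProdRelator
      (FreeLieAlgebra.of F (Sum.inr (c • x)) - c • FreeLieAlgebra.of F (Sum.inr x))
  | lie_right (x y : L₂) : FreeProdRelator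
      (FreeLieAlgebra.of F (Sum.inr ⁅x, y⁆) -
        ⁅FreeLieAlgebra.of F (Sum.inr x : L₁ ⊕ L₂), FreeLieAlgebra.of F (Sum.inr y : L₁ ⊕ L₂)⁆)

/-- The ideal generated by the relators of the free product. -/
def freeProdIdeal : LieIdeal F (FreeLieAlgebra F (L₁ ⊕ L₂)) :=
  LieSubmodule.lieSpan F (FreeLieAlgebra F (L₁ ⊕ L₂)) {x | FreeProdRelator F L₁ L₂ x}

/-- The free product (coproduct) `L₁ * L₂` of two Lie algebras over `F`. -/
abbrev FreeProd : Type _ := FreeLieAlgebra F (L₁ ⊕ L₂) ⧸ freeProdIdeal F L₁ L₂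

variable {F L₁ L₂}

theorem FreeProdRelator.quotMk_eq_zero {x : FreeLieAlgebra F (L₁ ⊕ L₂)}
    (h : FreeProdRelator F L₁ L₂ x) : quotMk (freeProdIdeal F L₁ L₂) x = 0 :=
  LieSubmodule.Quotient.mk_eq_zero'.mpr (LieSubmodule.subset_lieSpan h)

variable (F L₁ L₂)

/-- The natural morphism `L₁ → L₁ * L₂`. -/
def FreeProd.inl : L₁ →ₗ⁅F⁆ FreeProd F L₁ L₂ where
  toFun x := quotMk (freeProdIdeal F L₁ L₂) (FreeLieAlgebra.of F (Sum.inl x))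
  map_add' x y := by
    simpa [sub_eq_zero] using (FreeProdRelator.add_left (F := F) (L₂ := L₂) x y).quotMk_eq_zero
  map_smul' c x := by
    simpa [sub_eq_zero] using (FreeProdRelator.smul_left (F := F) (L₂ := L₂) c x).quotMk_eq_zero
  map_lie' {x y} := by
    simpa [sub_eq_zero] using (FreeProdRelator.lie_left (F := F) (L₂ := L₂) x y).quotMk_eq_zero

/-- The natural morphism `L₂ → L₁ * L₂`. -/
def FreeProd.inr : L₂ →ₗ⁅F⁆ FreeProd F L₁ L₂ where
  toFun x := quotMk (freeProdIdeal F L₁ L₂) (FreeLieAlgebra.of F (Sum.inr x))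
  map_add' x y := by
    simpa [sub_eq_zero] using (FreeProdRelator.add_right (F := F) (L₁ := L₁) x y).quotMk_eq_zero
  map_smul' c x := by
    simpa [sub_eq_zero] using (FreeProdRelator.smul_right (F := F) (L₁ := L₁) c x).quotMk_eq_zero
  map_lie' {x y} := by
    simpa [sub_eq_zero] using (FreeProdRelator.lie_right (F := F) (L₁ := L₁) x y).quotMk_eq_zero

variable {F L₁ L₂} {M : Type z} [LieRing M] [LieAlgebra F M]

/-- The morphism `L₁ * L₂ → M` given by two morphisms `L₁ → M` and `L₂ → M`. -/
def FreeProd.lift (f : L₁ →ₗ⁅F⁆ M) (g : L₂ →ₗ⁅F⁆ M) : FreeProd F L₁ L₂ →ₗ⁅F⁆ M :=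
  quotLift (freeProdIdeal F L₁ L₂) (FreeLieAlgebra.lift F (Sum.elim f g)) (by
    rw [freeProdIdeal, LieSubmodule.lieSpan_le]
    rintro x hx
    rw [SetLike.mem_coe, LieHom.mem_ker]
    cases hx <;> simp)

theorem FreeProd.lift_inl (f : L₁ →ₗ⁅F⁆ M) (g : L₂ →ₗ⁅F⁆ M) (x : L₁) :
    FreeProd.lift f g (FreeProd.inl F L₁ L₂ x) = f x :=
  (quotLift_mk _ _ _ _).trans (by simp)

theorem FreeProd.lift_inr (f : L₁ →ₗ⁅F⁆ M) (g : L₂ →ₗ⁅F⁆ M) (x : L₂) :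
    FreeProd.lift f g (FreeProd.inr F L₁ L₂ x) = g x :=
  (quotLift_mk _ _ _ _).trans (by simp)

/-- The free product `N₁ * N₂` of two ideals, regarded as a subalgebra of `L₁ * L₂` through the
natural morphism `N₁ * N₂ → L₁ * L₂`. -/
def freeProdSubalgebra (N₁ : LieIdeal F L₁) (N₂ : LieIdeal F L₂) :
    LieSubalgebra F (FreeProd F L₁ L₂) :=
  (FreeProd.lift ((FreeProd.inl F L₁ L₂).comp N₁.incl)
    ((FreeProd.inr F L₁ L₂).comp N₂.incl) :
      FreeProd F N₁ N₂ →ₗ⁅F⁆ FreeProd F L₁ L₂).range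

/-- The ideal `N₁ ⊕ N₂` of the direct sum `L₁ ⊕ L₂`. -/
def prodIdeal (N₁ : LieIdeal F L₁) (N₂ : LieIdeal F L₂) : LieIdeal F (L₁ × L₂) :=
  LieIdeal.comap (LieHom.fst F L₁ L₂) N₁ ⊓ LieIdeal.comap (LieHom.snd F L₁ L₂) N₂

theorem mem_prodIdeal (N₁ : LieIdeal F L₁) (N₂ : LieIdeal F L₂) (x : L₁ × L₂) :
    x ∈ prodIdeal N₁ N₂ ↔ x.1 ∈ N₁ ∧ x.2 ∈ N₂ := by
  simp [prodIdeal]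

end FreeProduct

section Tensor

variable {F : Type u} {L : Type v} {N : Type w} [Field F] [LieRing L] [LieAlgebra F L]
  [LieRing N] [LieAlgebra F N]

/-- The relators of the nonabelian tensor product `L ⊗ N` of two Lie algebras acting on each
other: `φ l n` is `ˡn` and `ψ n l` is `ⁿl`. An action of `L` on `N` is a morphism of Lie algebras
from `L` to the derivations of `N`. -/
inductive TensorRelator (φ : L →ₗ⁅F⁆ LieDerivation F N N) (ψ : N →ₗ⁅F⁆ LieDerivation F L L) :
    FreeLieAlgebra F (L × N) → Prop
  | smul_left (c : F) (l : L) (n : N) : TensorRelator φ ψ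
      (c • FreeLieAlgebra.of F (l, n) - FreeLieAlgebra.of F (c • l, n))
  | smul_right (c : F) (l : L) (n : N) : TensorRelator φ ψ
      (c • FreeLieAlgebra.of F (l, n) - FreeLieAlgebra.of F (l, c • n))
  | add_left (l l' : L) (n : N) : TensorRelator φ ψ
      (FreeLieAlgebra.of F (l + l', n) -
        (FreeLieAlgebra.of F (l, n) + FreeLieAlgebra.of F (l', n)))
  | add_right (l : L) (n n' : N) : TensorRelator φ ψ
      (FreeLieAlgebra.of F (l, n + n') -
        (FreeLieAlgebra.of F (l, n) + FreeLieAlgebra.of F (l, n')))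
  | lie_left (l l' : L) (n : N) : TensorRelator φ ψ
      (FreeLieAlgebra.of F (⁅l, l'⁆, n) -
        (FreeLieAlgebra.of F (l, φ l' n) - FreeLieAlgebra.of F (l', φ l n)))
  | lie_right (l : L) (n n' : N) : TensorRelator φ ψ
      (FreeLieAlgebra.of F (l, ⁅n, n'⁆) -
        (FreeLieAlgebra.of F (ψ n' l, n) - FreeLieAlgebra.of F (ψ n l, n')))
  | lie_lie (l l' : L) (n n' : N) : TensorRelator φ ψ
      (⁅FreeLieAlgebra.of F (l, n), FreeLieAlgebra.of F (l', n')⁆ -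
        (-FreeLieAlgebra.of F (ψ n l, φ l' n')))

/-- The ideal generated by the relators of the nonabelian tensor product. -/
def tensorIdeal (φ : L →ₗ⁅F⁆ LieDerivation F N N) (ψ : N →ₗ⁅F⁆ LieDerivation F L L) :
    LieIdeal F (FreeLieAlgebra F (L × N)) :=
  LieSubmodule.lieSpan F (FreeLieAlgebra F (L × N)) {x | TensorRelator φ ψ x}

/-- The nonabelian tensor product `L ⊗ N` with respect to mutual actions `φ` and `ψ`. -/
abbrev NonabTensor (φ : L →ₗ⁅F⁆ LieDerivation F N N) (ψ : N →ₗ⁅F⁆ LieDerivation F L L) :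
    Type _ :=
  FreeLieAlgebra F (L × N) ⧸ tensorIdeal φ ψ

/-- The generator `l ⊗ n`. -/
def tmul (φ : L →ₗ⁅F⁆ LieDerivation F N N) (ψ : N →ₗ⁅F⁆ LieDerivation F L L) (l : L) (n : N) :
    NonabTensor φ ψ :=
  quotMk (tensorIdeal φ ψ) (FreeLieAlgebra.of F (l, n))

end Tensor

section Pair

variable {F : Type u} {L : Type v} [Field F] [LieRing L] [LieAlgebra F L]

/-- The action of `L` on its ideal `N` by Lie multiplication. -/
def actOnIdeal (N : LieIdeal F L) : L →ₗ⁅F⁆ LieDerivation F N N where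
  toFun l :=
    { toFun := fun n => ⟨⁅l, (n : L)⁆, N.lie_mem n.2⟩
      map_add' := fun n n' => Subtype.ext (lie_add l (n : L) (n' : L))
      map_smul' := fun c n => Subtype.ext (lie_smul c l (n : L))
      leibniz' := fun n n' => Subtype.ext (by
        change ⁅l, ⁅(n : L), (n' : L)⁆⁆ = ⁅(n : L), ⁅l, (n' : L)⁆⁆ - ⁅(n' : L), ⁅l, (n : L)⁆⁆
        rw [leibniz_lie l (n : L) (n' : L), ← lie_skew (n' : L) ⁅l, (n : L)⁆]
        abel) }
  map_add' l l' := LieDerivation.ext fun n => Subtype.ext (add_lie l l' (n : L))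
  map_smul' c l := LieDerivation.ext fun n => Subtype.ext (smul_lie c l (n : L))
  map_lie' {l l'} := LieDerivation.ext fun n => by
    rw [LieDerivation.commutator_apply]
    exact Subtype.ext (lie_lie l l' (n : L))

/-- The action of an ideal `N` on `L` by Lie multiplication. -/
def idealAct (N : LieIdeal F L) : N →ₗ⁅F⁆ LieDerivation F L L :=
  (LieDerivation.ad F L).comp N.incl

theorem idealAct_apply (N : LieIdeal F L) (n : N) (l : L) : idealAct N n l = ⁅(n : L), l⁆ := by
  simp [idealAct]

/-- The nonabelian tensor product `L ⊗ N` of a pair `(L, N)`. -/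
abbrev PairTensor (N : LieIdeal F L) : Type _ := NonabTensor (actOnIdeal N) (idealAct N)

/-- The commutator map `κ : L ⊗ N → L`, `l ⊗ n ↦ [l, n]`; its image is `[L, N]`. -/
def kappa (N : LieIdeal F L) : PairTensor N →ₗ⁅F⁆ L :=
  quotLift (tensorIdeal (actOnIdeal N) (idealAct N))
    (FreeLieAlgebra.lift F fun p : L × N => ⁅p.1, (p.2 : L)⁆) (by
      rw [tensorIdeal, LieSubmodule.lieSpan_le]
      rintro x hx
      rw [SetLike.mem_coe, LieHom.mem_ker]
      cases hx with
      | smul_left c l n => simp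
      | smul_right c l n => simp
      | add_left l l' n => simp
      | add_right l n n' => simp
      | lie_left l l' n =>
        simp only [map_sub, FreeLieAlgebra.lift_of_apply]
        change ⁅⁅l, l'⁆, (n : L)⁆ - (⁅l, ⁅l', (n : L)⁆⁆ - ⁅l', ⁅l, (n : L)⁆⁆) = 0
        rw [lie_lie, sub_self]
      | lie_right l n n' =>
        simp only [map_sub, FreeLieAlgebra.lift_of_apply, idealAct_apply]
        change ⁅l, ⁅(n : L), (n' : L)⁆⁆ - (⁅⁅(n' : L), l⁆, (n : L)⁆ - ⁅⁅(n : L), l⁆, (n' : L)⁆) = 0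
        rw [leibniz_lie l (n : L) (n' : L), ← lie_skew l (n : L), neg_lie,
          ← lie_skew (n : L) ⁅l, (n' : L)⁆, ← lie_skew l (n' : L), neg_lie]
        abel
      | lie_lie l l' n n' =>
        simp only [map_sub, map_neg, LieHom.map_lie, FreeLieAlgebra.lift_of_apply,
          idealAct_apply]
        change ⁅⁅l, (n : L)⁆, ⁅l', (n' : L)⁆⁆ - (-⁅⁅(n : L), l⁆, ⁅l', (n' : L)⁆⁆) = 0
        rw [← lie_skew l (n : L), neg_lie, sub_self])

theorem kappa_tmul (N : LieIdeal F L) (l : L) (n : N) :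
    kappa N (tmul (actOnIdeal N) (idealAct N) l n) = ⁅l, (n : L)⁆ :=
  (quotLift_mk _ _ _ _).trans (by simp)

/-- `J₂(L, N)`, the kernel of `κ`. -/
def J₂ (N : LieIdeal F L) : LieIdeal F (PairTensor N) := (kappa N).ker

/-- The diagonal ideal `L □ N` of `L ⊗ N`, generated by the elements `n ⊗ n` with `n ∈ N`. -/
def diagonal (N : LieIdeal F L) : LieIdeal F (PairTensor N) :=
  LieSubmodule.lieSpan F (PairTensor N)
    {t | ∃ n : N, t = tmul (actOnIdeal N) (idealAct N) (n : L) n}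

/-- The nonabelian exterior product `L ∧ N = (L ⊗ N) / (L □ N)`. -/
abbrev PairExterior (N : LieIdeal F L) : Type _ := PairTensor N ⧸ diagonal N

/-- The commutator map `κ' : L ∧ N → L`, `l ∧ n ↦ [l, n]`. -/
def kappa' (N : LieIdeal F L) : PairExterior N →ₗ⁅F⁆ L :=
  quotLift (diagonal N) (kappa N) (by
    rw [diagonal, LieSubmodule.lieSpan_le]
    rintro x ⟨n, rfl⟩
    rw [SetLike.mem_coe, LieHom.mem_ker, kappa_tmul, lie_self])

/-- The Schur multiplier `M(L, N)` of the pair `(L, N)`, as the kernel of `κ'`. -/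
def schurMultiplier (N : LieIdeal F L) : LieIdeal F (PairExterior N) := (kappa' N).ker

/-- The abelian Lie algebra `N / [N, L]`. -/
abbrev Coinv (N : LieIdeal F L) : Type _ :=
  N ⧸ LieIdeal.comap N.incl ⁅N, (⊤ : LieIdeal F L)⁆

end Pair

end LiePair

end

/-! The hypothesis that `N₁ * N₂` is an ideal is very rigid, because nonzero elements of the two
factors of a free product never commute (`FreeProd.lie_inl_inr_ne_zero`). Let `x ≠ 0` lie in `N₁`
and `y` outside `N₂`. The bracket of `x` and `y` lies in `N₁ * N₂`, whose image in `L₁ * (L₂ / N₂)`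
is contained in `L₁`; projecting to `L₁` shows that this image of the bracket is zero, which is
impossible. Hence some `Lᵢ` is zero, or both `Nᵢ` are zero, or both `Nᵢ = Lᵢ`. The first two cases
are formal, and the third concerns the tensor square of `G = L₁ * L₂`.

Noncommutation requires representations on which given nonzero elements act nontrivially. They come
from the embedding half of Poincaré–Birkhoff–Witt: a function on basis letters extends, length by
length, to words so that `u a b v - u b a v = u [a, b] v`. The correction at each length is the
total increment along a sorting of the word. Its independence of the path rests on the Coxeter
relations, and the braid relation among them is the Jacobi identity.

For `G` the central fact is `J₂_freeProd_le`. Modulo a subspace `C` that contains all `x ⊗ x` and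
the images of both `J₂(Lᵢ)`, the tensor is a two-cocycle on `G` that is a coboundary on each factor.
The universal property of the free product splits the corresponding central extension, so the
cocycle is a coboundary on `G`, the quotient map by `C` factors through `κ`, and `J₂(G) ≤ C`.

Finally, `x ⊗ x` depends only on the class of `x` modulo `[G, G]`, and modulo `[G, G]` every element
is a sum `a + b` from the factors. Thus `x ⊗ x` is `a ⊗ a + b ⊗ b` plus the mixed term `a ⊗ b + b ⊗
a`. The mixed terms form a copy of the tensor product of the abelianizations, which yields (i). They
die in the exterior square, which yields (iii). The diagonal sees only the abelianization, which `G`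
shares with `L₁ × L₂`, and this yields (ii). -/

noncomputable section

namespace LiePair

universe u v w z

/-! ### Path independence of increments along adjacent transpositions. -/

section SwapCocycle

variable {ι V : Type*} [LinearOrder ι] [AddCommGroup V]

/-- A system of increments along the adjacent transpositions `u a b v ⟶ u b a v` of words that
satisfies the Coxeter relations of the symmetric groups. -/
structure IsSwapCocycle (D : List ι → ι → ι → List ι → V) : Prop where
  self : ∀ u a v, D u a a v = 0
  skew : ∀ u a b v, D u b a v = -D u a b v
  comm : ∀ u a b v c d w, D u a b (v ++ c :: d :: w) + D (u ++ b :: a :: v) c d w =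
    D (u ++ a :: b :: v) c d w + D u a b (v ++ d :: c :: w)
  braid : ∀ u a b c v, D u a b (c :: v) + D (u ++ [b]) a c v + D u b c (a :: v) =
    D (u ++ [a]) b c v + D u a c (b :: v) + D (u ++ [c]) a b v

variable (D : List ι → ι → ι → List ι → V)

/-- The total increment when `x` is inserted into a word standing to its right. -/
def insertIncr (u : List ι) (x : ι) : List ι → V
  | [] => 0
  | y :: t => if x ≤ y then 0 else D u x y t + insertIncr (u ++ [y]) x t
termination_by t => t.length

/-- The total increment when a word is sorted by insertion. -/
def sortIncr (u : List ι) : List ι → V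
  | [] => 0
  | x :: t => sortIncr (u ++ [x]) t + insertIncr D u x (t.insertionSort (· ≤ ·))
termination_by t => t.length

theorem insertIncr_nil (u : List ι) (x : ι) : insertIncr D u x [] = 0 := by
  rw [insertIncr]

theorem insertIncr_of_le (u : List ι) {x y : ι} (t : List ι) (h : x ≤ y) :
    insertIncr D u x (y :: t) = 0 := by
  rw [insertIncr, if_pos h]

theorem insertIncr_of_lt (u : List ι) {x y : ι} (t : List ι) (h : y < x) :
    insertIncr D u x (y :: t) = D u x y t + insertIncr D (u ++ [y]) x t := by
  rw [insertIncr, if_neg (not_le.mpr h)]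

theorem sortIncr_nil (u : List ι) : sortIncr D u [] = 0 := by
  rw [sortIncr]

theorem sortIncr_cons (u : List ι) (x : ι) (t : List ι) :
    sortIncr D u (x :: t) =
      sortIncr D (u ++ [x]) t + insertIncr D u x (t.insertionSort (· ≤ ·)) := by
  rw [sortIncr]

theorem orderedInsert_of_lt {x y : ι} (t : List ι) (h : y < x) :
    (y :: t).orderedInsert (· ≤ ·) x = y :: t.orderedInsert (· ≤ ·) x := by
  rw [List.orderedInsert, if_neg (not_le.mpr h)]

theorem orderedInsert_of_le {x y : ι} (t : List ι) (h : x ≤ y) :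
    (y :: t).orderedInsert (· ≤ ·) x = x :: y :: t := by
  rw [List.orderedInsert, if_pos h]

variable {D}

/-- The swap of `a` and `c` and the insertion of `x` act on disjoint parts of the word, so the two
routes around the rectangle agree by `comm` at each step. The list `q` collects the letters that `x`
has passed. -/
theorem IsSwapCocycle.insertIncr_comm (hD : IsSwapCocycle D) (p : List ι) (a c x : ι)
    (t : List ι) : ∀ q : List ι, D p a c (q ++ x :: t) + insertIncr D (p ++ c :: a :: q) x t =
      insertIncr D (p ++ a :: c :: q) x t + D p a c (q ++ t.orderedInsert (· ≤ ·) x) := by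
  induction t with
  | nil => intro q; simp [insertIncr_nil]
  | cons y t ih =>
    intro q
    rcases le_or_gt x y with h | h
    · rw [insertIncr_of_le _ _ _ h, insertIncr_of_le _ _ _ h, orderedInsert_of_le _ h]
      abel
    · rw [insertIncr_of_lt _ _ _ h, insertIncr_of_lt _ _ _ h, orderedInsert_of_lt _ h,
        ← add_assoc, hD.comm]
      have := ih (q ++ [y])
      simp only [List.append_assoc, List.cons_append, List.nil_append] at this ⊢
      rw [add_assoc, this]
      abel

theorem IsSwapCocycle.sortIncr_comm (hD : IsSwapCocycle D) (p : List ι) (a b : ι)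
    (v : List ι) : ∀ q : List ι, D p a b (q ++ v) + sortIncr D (p ++ b :: a :: q) v =
      sortIncr D (p ++ a :: b :: q) v + D p a b (q ++ v.insertionSort (· ≤ ·)) := by
  induction v with
  | nil => intro q; simp [sortIncr_nil]
  | cons x t ih =>
    intro q
    have h₁ := ih (q ++ [x])
    have h₂ := hD.insertIncr_comm p a b x (t.insertionSort (· ≤ ·)) q
    simp only [List.append_assoc, List.cons_append, List.nil_append] at h₁
    rw [sortIncr_cons, sortIncr_cons, List.insertionSort_cons]
    simp only [List.append_assoc, List.cons_append]
    rw [← add_assoc, h₁, add_assoc, h₂]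
    abel

/-- Both sides are totals along routes from `p a b s` to the word in which `a` and `b` have been
inserted into `s`; the right side begins with the swap of `a` and `b`. This is the hexagon on which
path independence rests. -/
theorem IsSwapCocycle.insertIncr_swap_of_le (hD : IsSwapCocycle D) {a b : ι} (hab : a ≤ b)
    (s : List ι) : ∀ p : List ι,
    insertIncr D (p ++ [a]) b s + insertIncr D p a (s.orderedInsert (· ≤ ·) b) =
      D p a b s + insertIncr D (p ++ [b]) a s +
        insertIncr D p b (s.orderedInsert (· ≤ ·) a) := by
  rcases hab.eq_or_lt with rfl | hlt
  · intro p; rw [hD.self]; abel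
  induction s with
  | nil =>
    intro p
    simp only [List.orderedInsert_nil, insertIncr_nil]
    rw [insertIncr_of_le _ _ _ hab, insertIncr_of_lt _ _ _ hlt, insertIncr_nil, hD.skew]
    abel
  | cons c s ih =>
    intro p
    rcases le_or_gt a c with hac | hac
    · rw [orderedInsert_of_le _ hac, insertIncr_of_le _ (p ++ [b]) _ hac,
        insertIncr_of_lt _ _ _ hlt, hD.skew p a b]
      rcases le_or_gt b c with hbc | hbc
      · rw [orderedInsert_of_le _ hbc, insertIncr_of_le _ p _ hab]
        abel
      · rw [orderedInsert_of_lt _ hbc, insertIncr_of_le _ p _ hac]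
        abel
    · have hbc := hac.trans hlt
      rw [orderedInsert_of_lt _ hac, orderedInsert_of_lt _ hbc]
      rw [insertIncr_of_lt _ _ _ hbc, insertIncr_of_lt _ _ _ hac, insertIncr_of_lt _ _ _ hac,
        insertIncr_of_lt _ _ _ hbc]
      -- Here `c` precedes both letters. `braid` compares the two ways of moving `c` in front of `a`
      -- and `b`, the commutation lemmas slide the swaps with `c` past the remaining insertions, and
      -- induction treats the tail.
      have h₁ := ih (p ++ [c])
      have h₂ := hD.insertIncr_comm p a c b s []
      have h₃ := hD.insertIncr_comm p b c a s []
      have h₄ := hD.braid p a b c s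
      simp only [List.append_assoc, List.cons_append, List.nil_append] at h₁ h₂ h₃ h₄ ⊢
      linear_combination (norm := module) h₁ + h₃ - h₂ - h₄

theorem IsSwapCocycle.insertIncr_swap (hD : IsSwapCocycle D) (a b : ι) (s p : List ι) :
    insertIncr D (p ++ [a]) b s + insertIncr D p a (s.orderedInsert (· ≤ ·) b) =
      D p a b s + insertIncr D (p ++ [b]) a s +
        insertIncr D p b (s.orderedInsert (· ≤ ·) a) := by
  rcases le_total a b with h | h
  · exact hD.insertIncr_swap_of_le h s p
  · have := hD.insertIncr_swap_of_le h s p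
    rw [add_assoc (D p a b s), this, hD.skew p a b]
    abel

/-- This makes `sortIncr` a potential for `D`: its difference across any adjacent transposition is
the prescribed increment. -/
theorem IsSwapCocycle.sortIncr_swap (hD : IsSwapCocycle D) (a b : ι) (v u : List ι) :
    ∀ p : List ι, sortIncr D p (u ++ a :: b :: v) =
      sortIncr D p (u ++ b :: a :: v) + D (p ++ u) a b v := by
  induction u with
  | nil =>
    intro p
    simp only [List.nil_append, List.append_nil, sortIncr_cons, List.insertionSort_cons]
    have h₁ := hD.sortIncr_comm p a b v []
    have h₂ := hD.insertIncr_swap a b (v.insertionSort (· ≤ ·)) p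
    simp only [List.append_assoc, List.cons_append, List.nil_append] at h₁ ⊢
    rw [add_assoc, h₂]
    linear_combination (norm := module) -h₁
  | cons x u ih =>
    intro p
    -- The letter `x` is inserted into the same sorted word on both sides, so its contribution
    -- cancels.
    have hs : (u ++ a :: b :: v).insertionSort (· ≤ ·) =
        (u ++ b :: a :: v).insertionSort (· ≤ ·) := by
      refine List.Perm.eq_of_pairwise' (List.pairwise_insertionSort _ _)
        (List.pairwise_insertionSort _ _) ?_
      exact (List.perm_insertionSort _ _).trans
        (((List.Perm.swap b a v).append_left u).trans (List.perm_insertionSort _ _).symm)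
    simp only [List.cons_append, sortIncr_cons]
    rw [ih, hs]
    simp only [List.append_assoc, List.cons_append, List.nil_append]
    abel

end SwapCocycle

section Words

attribute [local instance] LieRing.ofAssociativeRing

/-! ### Extension of a function on letters to words, compatibly with the bracket. -/

section WordFunctions

variable {F L ι W : Type*} [Field F] [LieRing L] [LieAlgebra F L] [AddCommGroup W] [Module F W]
  (b : Module.Basis ι F L)

/-- A function on words in a basis of `L`, extended linearly in one letter: the value at `u x v`
for an element `x` of `L`. -/
def letterEval (f : List ι → W) (u v : List ι) : L →ₗ[F] W :=
  b.constr F fun k => f (u ++ k :: v)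

@[simp]
theorem letterEval_basis (f : List ι → W) (u v : List ι) (k : ι) :
    letterEval b f u v (b k) = f (u ++ k :: v) :=
  b.constr_basis F _ k

theorem letterEval_congr {f g : List ι → W} {u v : List ι}
    (h : ∀ k, f (u ++ k :: v) = g (u ++ k :: v)) : letterEval b f u v = letterEval b g u v :=
  b.ext fun k => by simp [h]

/-- A function on words, extended linearly in two letters. -/
def twoLetterEval (f : List ι → W) (u v w : List ι) : L →ₗ[F] L →ₗ[F] W :=
  b.constr F fun k => letterEval b f (u ++ k :: v) w

theorem twoLetterEval_basis_left (f : List ι → W) (u v w : List ι) (k : ι) (y : L) :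
    twoLetterEval b f u v w (b k) y = letterEval b f (u ++ k :: v) w y := by
  rw [twoLetterEval, b.constr_basis]

theorem twoLetterEval_basis_right (f : List ι → W) (u v w : List ι) (x : L) (l : ι) :
    twoLetterEval b f u v w x (b l) = letterEval b f u (v ++ l :: w) x := by
  have : (twoLetterEval b f u v w).flip (b l) = letterEval b f u (v ++ l :: w) :=
    b.ext fun k => by simp [twoLetterEval_basis_left]
  exact LinearMap.congr_fun this x

theorem constr_letterEval_left (f : List ι → W) (u v w : List ι) (x y : L) :
    b.constr F (fun k => letterEval b f (u ++ k :: v) w y) x = twoLetterEval b f u v w x y := by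
  have : b.constr F (fun k => letterEval b f (u ++ k :: v) w y) =
      (twoLetterEval b f u v w).flip y :=
    b.ext fun k => by simp [twoLetterEval_basis_left, b.constr_basis]
  exact LinearMap.congr_fun this x

/-- The relation `u a b v - u b a v = u [a, b] v` for the words with `m` letters on the left. -/
def RespectsLie (f : List ι → W) (m : ℕ) : Prop :=
  ∀ (u : List ι) (i j : ι) (v : List ι), u.length + v.length + 2 = m →
    f (u ++ i :: j :: v) - f (u ++ j :: i :: v) = letterEval b f u v ⁅b i, b j⁆

variable {b}

theorem RespectsLie.letterEval_swap {f : List ι → W} {m : ℕ} (hf : RespectsLie b f m)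
    {u v : List ι} (h : u.length + v.length + 2 = m) (x : L) (c : ι) :
    letterEval b f u (c :: v) x - letterEval b f (u ++ [c]) v x =
      letterEval b f u v ⁅x, b c⁆ := by
  have : letterEval b f u (c :: v) - letterEval b f (u ++ [c]) v =
      letterEval b f u v ∘ₗ (-(LieModule.toEnd F L L (b c) : L →ₗ[F] L)) :=
    b.ext fun k => by
      have := hf u k c v h
      simp only [LinearMap.sub_apply, letterEval_basis, List.append_assoc, List.cons_append,
        List.nil_append, LinearMap.comp_apply, LinearMap.neg_apply, LieModule.toEnd_apply_apply,
        lie_skew]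
      exact this
  rw [← lie_skew x, map_neg]
  simpa using LinearMap.congr_fun this x

theorem RespectsLie.letterEval_swap_right {f : List ι → W} {m : ℕ} (hf : RespectsLie b f m)
    {u v w : List ι} (h : u.length + v.length + w.length + 3 = m) (x : L) (i j : ι) :
    letterEval b f u (v ++ i :: j :: w) x - letterEval b f u (v ++ j :: i :: w) x =
      twoLetterEval b f u v w x ⁅b i, b j⁆ := by
  have : letterEval b f u (v ++ i :: j :: w) - letterEval b f u (v ++ j :: i :: w) =
      (twoLetterEval b f u v w).flip ⁅b i, b j⁆ :=
    b.ext fun k => by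
      have := hf (u ++ k :: v) i j w (by simp; omega)
      simpa [twoLetterEval_basis_left] using this
  exact LinearMap.congr_fun this x

theorem RespectsLie.letterEval_swap_left {f : List ι → W} {m : ℕ} (hf : RespectsLie b f m)
    {u v w : List ι} (h : u.length + v.length + w.length + 3 = m) (x : L) (i j : ι) :
    letterEval b f (u ++ i :: j :: v) w x - letterEval b f (u ++ j :: i :: v) w x =
      twoLetterEval b f u v w ⁅b i, b j⁆ x := by
  have : letterEval b f (u ++ i :: j :: v) w - letterEval b f (u ++ j :: i :: v) w =
      twoLetterEval b f u v w ⁅b i, b j⁆ :=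
    b.ext fun k => by
      have := hf u i j (v ++ k :: w) (by simp; omega)
      simpa [twoLetterEval_basis_right] using this
  exact LinearMap.congr_fun this x

variable (b)

/-- The increments `u [a, b] v` on words with `n + 2` letters. -/
def lieIncr (f : List ι → W) (n : ℕ) (u : List ι) (i j : ι) (v : List ι) : W :=
  -- The value zero at other lengths lets the cocycle identities hold for all words and confines the
  -- correction to words of `n + 2` letters.
  if u.length + v.length = n then letterEval b f u v ⁅b i, b j⁆ else 0

variable {b}

/-- The words in `u [a, b] v` have one letter fewer than those being swapped, so the relation at
length `n + 1` controls the increments at length `n + 2`. Commutation of disjoint swaps is this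
relation applied at two places, and the braid relation reduces to the Jacobi identity. -/
theorem RespectsLie.isSwapCocycle [LinearOrder ι] {f : List ι → W} {n : ℕ}
    (hf : RespectsLie b f (n + 1)) : IsSwapCocycle (lieIncr b f n) where
  self u i v := by simp [lieIncr]
  skew u i j v := by
    unfold lieIncr
    split_ifs
    · rw [← lie_skew, map_neg]
    · simp
  comm u i j v c d w := by
    by_cases h : u.length + v.length + w.length + 2 = n
    · have h₁ := hf.letterEval_swap_right (u := u) (v := v) (w := w) (by omega) ⁅b i, b j⁆ c d
      have h₂ := hf.letterEval_swap_left (u := u) (v := v) (w := w) (by omega) ⁅b c, b d⁆ i j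
      unfold lieIncr
      simp only [List.length_append, List.length_cons]
      rw [if_pos (by omega), if_pos (by omega), if_pos (by omega), if_pos (by omega)]
      linear_combination (norm := module) h₁ - h₂
    · unfold lieIncr
      simp only [List.length_append, List.length_cons]
      rw [if_neg (by omega), if_neg (by omega), if_neg (by omega), if_neg (by omega)]
  braid u i j k v := by
    by_cases h : u.length + v.length + 1 = n
    · have h₁ := hf.letterEval_swap (u := u) (v := v) (by omega) ⁅b i, b j⁆ k
      have h₂ := hf.letterEval_swap (u := u) (v := v) (by omega) ⁅b i, b k⁆ j
      have h₃ := hf.letterEval_swap (u := u) (v := v) (by omega) ⁅b j, b k⁆ i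
      have h₄ : ⁅⁅b i, b j⁆, b k⁆ - ⁅⁅b i, b k⁆, b j⁆ + ⁅⁅b j, b k⁆, b i⁆ = 0 := by
        have e₁ : ⁅⁅b i, b j⁆, b k⁆ = -⁅b k, ⁅b i, b j⁆⁆ := (lie_skew _ _).symm
        have e₂ : ⁅⁅b j, b k⁆, b i⁆ = -⁅b i, ⁅b j, b k⁆⁆ := (lie_skew _ _).symm
        have e₃ : ⁅⁅b i, b k⁆, b j⁆ = ⁅b j, ⁅b k, b i⁆⁆ := by
          rw [← lie_skew (b i) (b k), neg_lie, lie_skew]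
        rw [e₁, e₂, e₃]
        have := lie_jacobi (b i) (b j) (b k)
        linear_combination (norm := module) -this
      have h₅ := congrArg (letterEval b f u v) h₄
      rw [map_add, map_sub, map_zero] at h₅
      unfold lieIncr
      simp only [List.length_append, List.length_cons, List.length_nil]
      rw [if_pos (by omega), if_pos (by omega), if_pos (by omega), if_pos (by omega),
        if_pos (by omega), if_pos (by omega)]
      linear_combination (norm := module) h₁ - h₂ + h₃ + h₅
    · unfold lieIncr
      simp only [List.length_append, List.length_cons, List.length_nil]
      rw [if_neg (by omega), if_neg (by omega), if_neg (by omega), if_neg (by omega),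
        if_neg (by omega), if_neg (by omega)]

variable [LinearOrder ι]

theorem insertIncr_lieIncr_eq_zero (f : List ι → W) (n : ℕ) (x : ι) (t : List ι) :
    ∀ u : List ι, u.length + t.length ≠ n + 1 → insertIncr (lieIncr b f n) u x t = 0 := by
  induction t with
  | nil => intro u _; exact insertIncr_nil _ _ _
  | cons y t ih =>
    intro u h
    rcases le_or_gt x y with hxy | hxy
    · exact insertIncr_of_le _ _ _ hxy
    · simp only [List.length_cons] at h
      rw [insertIncr_of_lt _ _ _ hxy, ih _ (by simp; omega), lieIncr, if_neg (by omega), add_zero]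

theorem sortIncr_lieIncr_eq_zero (f : List ι → W) (n : ℕ) (t : List ι) :
    ∀ u : List ι, u.length + t.length ≠ n + 2 → sortIncr (lieIncr b f n) u t = 0 := by
  induction t with
  | nil => intro u _; exact sortIncr_nil _ _
  | cons y t ih =>
    intro u h
    simp only [List.length_cons] at h
    rw [sortIncr_cons, ih _ (by simp; omega),
      insertIncr_lieIncr_eq_zero _ _ _ _ _ (by simp; omega), add_zero]

variable (b) (g : ι → W)

/-- The successive approximations to a function on words that respects the Lie bracket, extends
`g` and vanishes on the sorted words of length other than one. -/
def wordStage : ℕ → List ι → W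
  | 0 => fun w => match w with
    | [i] => g i
    | _ => 0
  | n + 1 => fun w => wordStage n w + sortIncr (lieIncr b (wordStage n) n) [] w

theorem wordStage_succ (n : ℕ) (w : List ι) : wordStage b g (n + 1) w =
    wordStage b g n w + sortIncr (lieIncr b (wordStage b g n) n) [] w := rfl

theorem wordStage_succ_of_ne {n : ℕ} {w : List ι} (h : w.length ≠ n + 2) :
    wordStage b g (n + 1) w = wordStage b g n w := by
  rw [wordStage_succ, sortIncr_lieIncr_eq_zero _ _ _ _ (by simpa using h), add_zero]

theorem wordStage_eq_zero {n : ℕ} : ∀ {w : List ι}, n + 1 < w.length → wordStage b g n w = 0 := by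
  induction n with
  | zero =>
    intro w h
    match w, h with
    | _ :: _ :: _, _ => rfl
  | succ n ih =>
    intro w h
    rw [wordStage_succ_of_ne b g (by omega), ih (by omega)]

/-- Passing to stage `n + 1` changes only words of `n + 2` letters, on which stage `n` vanishes.
There the new value is the potential of the increments `u [a, b] v`, and those are computed on words
of `n + 1` letters, which stay unchanged. At stage zero no pair of letters fits. -/
theorem wordStage_respectsLie (n : ℕ) : ∀ m ≤ n + 1, RespectsLie b (wordStage b g n) m := by
  induction n with
  | zero => intro m hm u i j v h; omega
  | succ n ih =>
    intro m hm u i j v h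
    have hle : letterEval b (wordStage b g (n + 1)) u v = letterEval b (wordStage b g n) u v :=
      letterEval_congr b fun k => wordStage_succ_of_ne b g (by simp; omega)
    rw [hle]
    rcases hm.lt_or_eq with hm | hm
    · rw [wordStage_succ_of_ne b g (by simp; omega), wordStage_succ_of_ne b g (by simp; omega)]
      exact ih m (by omega) u i j v h
    · rw [wordStage_succ, wordStage_succ, wordStage_eq_zero b g (by simp; omega),
        wordStage_eq_zero b g (by simp; omega),
        (ih _ le_rfl).isSwapCocycle.sortIncr_swap, lieIncr, if_pos (by simp; omega)]
      simp

/-- A function on words that respects the Lie bracket and extends `g`. -/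
def wordExtend (w : List ι) : W := wordStage b g w.length w

theorem wordStage_eq_wordExtend {n : ℕ} {w : List ι} (h : w.length ≤ n) :
    wordStage b g n w = wordExtend b g w := by
  induction n, h using Nat.le_induction with
  | base => rfl
  | succ n hn ih => rw [wordStage_succ_of_ne b g (by omega), ih]

theorem wordExtend_singleton (i : ι) : wordExtend b g [i] = g i := by
  change wordStage b g 1 [i] = g i
  rw [wordStage_succ_of_ne b g (by simp)]
  rfl

theorem wordExtend_respectsLie (m : ℕ) : RespectsLie b (wordExtend b g) m := by
  intro u i j v h
  rw [← letterEval_congr b fun k => wordStage_eq_wordExtend b g (n := m) (by simp; omega),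
    ← wordStage_eq_wordExtend b g (n := m) (by simp; omega),
    ← wordStage_eq_wordExtend b g (n := m) (by simp; omega)]
  exact wordStage_respectsLie b g m m (by omega) u i j v h

end WordFunctions

/-! ### The coinduced representation on word functions. -/

section Representation

variable {F L ι : Type*} [Field F] [LieRing L] [LieAlgebra F L] (b : Module.Basis ι F L)
  (W : Type*) [AddCommGroup W] [Module F W]

/-- The functions on words in a basis of `L` that respect the Lie bracket; they form the space of
linear maps from the enveloping algebra of `L` to `W`. -/
def wordModule : Submodule F (List ι → W) where
  carrier := {f | ∀ m, RespectsLie b f m}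
  zero_mem' m u i j v _ := by
    have : letterEval b (0 : List ι → W) u v = 0 := b.ext fun k => by simp
    simp [this]
  add_mem' {f g} hf hg m u i j v h := by
    have : letterEval b (f + g) u v = letterEval b f u v + letterEval b g u v :=
      b.ext fun k => by simp
    rw [this, LinearMap.add_apply, ← hf m u i j v h, ← hg m u i j v h]
    simp only [Pi.add_apply]
    abel
  smul_mem' c f hf m u i j v h := by
    have : letterEval b (c • f) u v = c • letterEval b f u v := b.ext fun k => by simp
    rw [this, LinearMap.smul_apply, ← hf m u i j v h, smul_sub]
    rfl

/-- The action of `L` on functions on words by right translation. -/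
def wordAction : L →ₗ⁅F⁆ Module.End F (wordModule b W) where
  toFun x :=
    { toFun := fun f => ⟨fun u => letterEval b f.1 u [] x, fun m u i j v h => by
        rw [(f.2 (m + 1)).letterEval_swap_left (w := []) (by simp; omega)]
        exact (constr_letterEval_left b f.1 u v [] ⁅b i, b j⁆ x).symm⟩
      map_add' := fun f g => Subtype.ext <| funext fun u => by
        have : letterEval b (f.1 + g.1) u [] = letterEval b f.1 u [] + letterEval b g.1 u [] :=
          b.ext fun k => by simp
        exact LinearMap.congr_fun this x
      map_smul' := fun c f => Subtype.ext <| funext fun u => by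
        have : letterEval b (c • f.1) u [] = c • letterEval b f.1 u [] :=
          b.ext fun k => by simp
        exact LinearMap.congr_fun this x }
  map_add' x y := LinearMap.ext fun f => Subtype.ext <| funext fun u =>
    map_add (letterEval b f.1 u []) x y
  map_smul' c x := LinearMap.ext fun f => Subtype.ext <| funext fun u =>
    map_smul (letterEval b f.1 u []) c x
  map_lie' {x y} := LinearMap.ext fun f => Subtype.ext <| funext fun u => by
    change letterEval b f.1 u [] ⁅x, y⁆ =
      letterEval b (fun u => letterEval b f.1 u [] y) u [] x -
        letterEval b (fun u => letterEval b f.1 u [] x) u [] y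
    have h₁ : ∀ x y : L, letterEval b (fun u => letterEval b f.1 u [] y) u [] x =
      twoLetterEval b f.1 u [] [] x y := constr_letterEval_left b f.1 u [] []
    rw [h₁, h₁]
    have : (LieModule.toEnd F L L : L →ₗ[F] L →ₗ[F] L).compr₂ (letterEval b f.1 u []) =
        twoLetterEval b f.1 u [] [] - (twoLetterEval b f.1 u [] []).flip :=
      b.ext fun i => b.ext fun j => by
        have := f.2 (u.length + 2) u i j [] (by simp)
        simpa [twoLetterEval_basis_left] using this.symm
    simpa using LinearMap.congr_fun₂ this x y

end Representation

/-- Every nonzero element of a Lie algebra over a field acts nontrivially on some representation. -/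
theorem exists_representation_ne_zero {F : Type u} {L : Type v} [Field F] [LieRing L]
    [LieAlgebra F L] {x : L} (hx : x ≠ 0) :
    ∃ (V : Type v) (_ : AddCommGroup V) (_ : Module F V) (ρ : L →ₗ⁅F⁆ Module.End F V),
      ρ x ≠ 0 := by
  let b := Module.Free.chooseBasis F L
  let _ : LinearOrder (Module.Free.ChooseBasisIndex F L) := IsWellOrder.linearOrder WellOrderingRel
  refine ⟨wordModule b L, inferInstance, inferInstance, wordAction b L, fun h => hx ?_⟩
  -- Taking the identity on letters as `g` and evaluating at the empty word, the action of `x`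
  -- returns `x` itself.
  have h₁ := congrArg (fun f : wordModule b L => f.1 [])
    (LinearMap.congr_fun h ⟨wordExtend b b, wordExtend_respectsLie b b⟩)
  have h₂ : letterEval b (wordExtend b b) [] [] = LinearMap.id :=
    b.ext fun k => by simp [wordExtend_singleton]
  have h₃ : letterEval b (wordExtend b b) [] [] x = 0 := h₁
  rwa [h₂] at h₃

/-! ### Noncommuting factors and the rigidity of the hypothesis. -/

section FreeProduct

variable {F : Type u} {L₁ : Type v} {L₂ : Type w} [Field F] [LieRing L₁] [LieAlgebra F L₁]
  [LieRing L₂] [LieAlgebra F L₂] {M : Type z} [LieRing M] [LieAlgebra F M]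

theorem quotMk_surjective {L : Type*} [LieRing L] [LieAlgebra F L] (I : LieIdeal F L) :
    Function.Surjective (quotMk I) :=
  LieSubmodule.Quotient.surjective_mk' I

theorem quotMk_eq_zero {L : Type*} [LieRing L] [LieAlgebra F L] {I : LieIdeal F L} {x : L} :
    quotMk I x = 0 ↔ x ∈ I :=
  LieSubmodule.Quotient.mk_eq_zero'

theorem quot_hom_ext {L : Type*} [LieRing L] [LieAlgebra F L] {I : LieIdeal F L}
    {f g : L ⧸ I →ₗ⁅F⁆ M} (h : f.comp (quotMk I) = g.comp (quotMk I)) : f = g :=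
  LieHom.ext fun x => by
    obtain ⟨x, rfl⟩ := quotMk_surjective I x
    exact LieHom.congr_fun h x

theorem FreeProd.hom_ext {f g : FreeProd F L₁ L₂ →ₗ⁅F⁆ M}
    (h₁ : ∀ x, f (FreeProd.inl F L₁ L₂ x) = g (FreeProd.inl F L₁ L₂ x))
    (h₂ : ∀ x, f (FreeProd.inr F L₁ L₂ x) = g (FreeProd.inr F L₁ L₂ x)) : f = g :=
  quot_hom_ext <| FreeLieAlgebra.hom_ext fun x => by
    rcases x with x | x
    · exact h₁ x
    · exact h₂ x

/-- The universal property maps the free product into `S`; the composite with the inclusion fixes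
both factors and is therefore the identity. -/
theorem FreeProd.subalgebra_eq_top {S : LieSubalgebra F (FreeProd F L₁ L₂)}
    (h₁ : ∀ x, FreeProd.inl F L₁ L₂ x ∈ S) (h₂ : ∀ x, FreeProd.inr F L₁ L₂ x ∈ S) : S = ⊤ := by
  let i₁ : L₁ →ₗ⁅F⁆ S :=
    { (FreeProd.inl F L₁ L₂ : L₁ →ₗ[F] FreeProd F L₁ L₂).codRestrict S.toSubmodule h₁ with
      map_lie' := fun {x y} => Subtype.ext ((FreeProd.inl F L₁ L₂).map_lie x y) }
  let i₂ : L₂ →ₗ⁅F⁆ S :=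
    { (FreeProd.inr F L₁ L₂ : L₂ →ₗ[F] FreeProd F L₁ L₂).codRestrict S.toSubmodule h₂ with
      map_lie' := fun {x y} => Subtype.ext ((FreeProd.inr F L₁ L₂).map_lie x y) }
  have h : S.incl.comp (FreeProd.lift i₁ i₂) = LieHom.id :=
    FreeProd.hom_ext (fun x => by simp only [LieHom.comp_apply, FreeProd.lift_inl]; rfl)
      (fun x => by simp only [LieHom.comp_apply, FreeProd.lift_inr]; rfl)
  refine eq_top_iff.mpr fun x _ => ?_
  have hx := LieHom.congr_fun h x
  rw [LieHom.comp_apply, LieHom.id_apply] at hx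
  exact hx ▸ (FreeProd.lift i₁ i₂ x).2

/-- In a free product, nonzero elements of the two factors do not commute. -/
theorem FreeProd.lie_inl_inr_ne_zero {x : L₁} {y : L₂} (hx : x ≠ 0) (hy : y ≠ 0) :
    ⁅FreeProd.inl F L₁ L₂ x, FreeProd.inr F L₁ L₂ y⁆ ≠ 0 := by
  obtain ⟨V₁, _, _, ρ₁, h₁⟩ := exists_representation_ne_zero (F := F) hx
  obtain ⟨V₂, _, _, ρ₂, h₂⟩ := exists_representation_ne_zero (F := F) hy
  obtain ⟨v₁, hv₁⟩ : ∃ v, ρ₁ x v ≠ 0 := by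
    by_contra! h
    exact h₁ (LinearMap.ext h)
  obtain ⟨v₂, hv₂⟩ : ∃ v, ρ₂ y v ≠ 0 := by
    by_contra! h
    exact h₂ (LinearMap.ext h)
  -- The map `τ` glues the two representations: on `V₁ × V₂` the first factor acts on `V₁` alone,
  -- and the second acts through `ρ₂` conjugated by the shear along `τ`.
  obtain ⟨τ, hτ⟩ : ∃ τ : V₁ →ₗ[F] V₂, τ (ρ₁ x v₁) = v₂ := by
    obtain ⟨φ, hφ⟩ := (LinearPMap.mkSpanSingleton (K := F) (ρ₁ x v₁) v₂ hv₁).toFun.exists_extend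
    refine ⟨φ, ?_⟩
    have := LinearMap.congr_fun hφ ⟨_, Submodule.mem_span_singleton_self _⟩
    exact this.trans (LinearPMap.mkSpanSingleton_apply F F hv₁ v₂)
  let f₁ : L₁ →ₗ⁅F⁆ Module.End F (V₁ × V₂) :=
    { toFun := fun a => (ρ₁ a).prodMap 0
      map_add' := fun a a' => by ext <;> simp
      map_smul' := fun c a => by ext <;> simp
      map_lie' := fun {a a'} => by ext <;> simp [Ring.lie_def] }
  let f₂ : L₂ →ₗ⁅F⁆ Module.End F (V₁ × V₂) :=
    { toFun := fun a => LinearMap.inr F V₁ V₂ ∘ₗ ρ₂ a ∘ₗ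
        (LinearMap.snd F V₁ V₂ - τ ∘ₗ LinearMap.fst F V₁ V₂)
      map_add' := fun a a' => by ext <;> simp
      map_smul' := fun c a => by ext <;> simp
      map_lie' := fun {a a'} => by ext <;> simp [Ring.lie_def] }
  intro h
  have h' := congrArg (FreeProd.lift f₁ f₂) h
  rw [LieHom.map_lie, FreeProd.lift_inl, FreeProd.lift_inr, map_zero, Ring.lie_def] at h'
  -- On `(v₁, 0)` the product `f₁ x * f₂ y` has second coordinate zero, and the other product has
  -- second coordinate `-ρ₂ y v₂`, so the commutator is nonzero there.
  have h'' := congrArg Prod.snd (LinearMap.congr_fun h' (v₁, 0))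
  simp [f₁, f₂, hτ] at h''
  exact hv₂ h''

theorem inl_mem {N₁ : LieIdeal F L₁} {N₂ : LieIdeal F L₂}
    {N : LieIdeal F (FreeProd F L₁ L₂)} (hN : N.toLieSubalgebra = freeProdSubalgebra N₁ N₂)
    {x : L₁} (hx : x ∈ N₁) : FreeProd.inl F L₁ L₂ x ∈ N := by
  change _ ∈ N.toLieSubalgebra
  rw [hN]
  exact ⟨FreeProd.inl F N₁ N₂ ⟨x, hx⟩, FreeProd.lift_inl _ _ _⟩

theorem inr_mem {N₁ : LieIdeal F L₁} {N₂ : LieIdeal F L₂}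
    {N : LieIdeal F (FreeProd F L₁ L₂)} (hN : N.toLieSubalgebra = freeProdSubalgebra N₁ N₂)
    {x : L₂} (hx : x ∈ N₂) : FreeProd.inr F L₁ L₂ x ∈ N := by
  change _ ∈ N.toLieSubalgebra
  rw [hN]
  exact ⟨FreeProd.inr F N₁ N₂ ⟨x, hx⟩, FreeProd.lift_inr _ _ _⟩

/-- Killing `N₂` in the second factor sends `N₁ * N₂` into the first factor. A bracket of `x` in
`N₁` with any `y` then becomes an element of `L₁`, and it is zero since the projection to `L₁` kills
the second factor. So `y` must die modulo `N₂`. -/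
theorem eq_top_right_of_freeProdSubalgebra {N₁ : LieIdeal F L₁} {N₂ : LieIdeal F L₂}
    {N : LieIdeal F (FreeProd F L₁ L₂)} (hN : N.toLieSubalgebra = freeProdSubalgebra N₁ N₂)
    (h : N₁ ≠ ⊥) : N₂ = ⊤ := by
  obtain ⟨x, hx, hx0⟩ : ∃ x ∈ N₁, x ≠ 0 := by
    by_contra! h'
    exact h ((LieSubmodule.eq_bot_iff N₁).mpr h')
  refine eq_top_iff.mpr fun y _ => ?_
  by_contra hy
  let Φ : FreeProd F L₁ L₂ →ₗ⁅F⁆ FreeProd F L₁ (L₂ ⧸ N₂) :=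
    FreeProd.lift (FreeProd.inl F _ _) ((FreeProd.inr F _ _).comp (quotMk N₂))
  let P : FreeProd F L₁ (L₂ ⧸ N₂) →ₗ⁅F⁆ L₁ := FreeProd.lift LieHom.id 0
  let p : FreeProd F N₁ N₂ →ₗ⁅F⁆ L₁ := FreeProd.lift N₁.incl 0
  have hΦ : Φ.comp (FreeProd.lift ((FreeProd.inl F L₁ L₂).comp N₁.incl)
      ((FreeProd.inr F L₁ L₂).comp N₂.incl)) = (FreeProd.inl F _ _).comp p := by
    refine FreeProd.hom_ext (fun a => ?_) (fun a => ?_)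
    · simp [Φ, p, FreeProd.lift_inl]
    · have : quotMk N₂ (a : L₂) = 0 := quotMk_eq_zero.mpr a.2
      simp [Φ, p, FreeProd.lift_inr, this]
  have hmem : ⁅FreeProd.inl F L₁ L₂ x, FreeProd.inr F L₁ L₂ y⁆ ∈ N.toLieSubalgebra :=
    lie_mem_left F _ N _ _ (inl_mem hN hx)
  rw [hN] at hmem
  obtain ⟨t, ht⟩ := hmem
  have h₁ : Φ ⁅FreeProd.inl F L₁ L₂ x, FreeProd.inr F L₁ L₂ y⁆ = FreeProd.inl F _ _ (p t) := by
    rw [← ht]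
    exact LieHom.congr_fun hΦ t
  have h₂ : Φ ⁅FreeProd.inl F L₁ L₂ x, FreeProd.inr F L₁ L₂ y⁆ =
      ⁅FreeProd.inl F L₁ (L₂ ⧸ N₂) x, FreeProd.inr F _ _ (quotMk N₂ y)⁆ := by
    simp [Φ, FreeProd.lift_inl, FreeProd.lift_inr]
  rw [h₂] at h₁
  have h₃ : p t = 0 := by
    have := congrArg P h₁
    simpa [P, FreeProd.lift_inl, FreeProd.lift_inr] using this.symm
  rw [h₃, map_zero] at h₁
  exact FreeProd.lie_inl_inr_ne_zero hx0 (fun h => hy (quotMk_eq_zero.mp h)) h₁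

theorem eq_top_left_of_freeProdSubalgebra {N₁ : LieIdeal F L₁} {N₂ : LieIdeal F L₂}
    {N : LieIdeal F (FreeProd F L₁ L₂)} (hN : N.toLieSubalgebra = freeProdSubalgebra N₁ N₂)
    (h : N₂ ≠ ⊥) : N₁ = ⊤ := by
  obtain ⟨y, hy, hy0⟩ : ∃ y ∈ N₂, y ≠ 0 := by
    by_contra! h'
    exact h ((LieSubmodule.eq_bot_iff N₂).mpr h')
  refine eq_top_iff.mpr fun x _ => ?_
  by_contra hx
  let Φ : FreeProd F L₁ L₂ →ₗ⁅F⁆ FreeProd F (L₁ ⧸ N₁) L₂ :=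
    FreeProd.lift ((FreeProd.inl F _ _).comp (quotMk N₁)) (FreeProd.inr F _ _)
  let P : FreeProd F (L₁ ⧸ N₁) L₂ →ₗ⁅F⁆ L₂ := FreeProd.lift 0 LieHom.id
  let p : FreeProd F N₁ N₂ →ₗ⁅F⁆ L₂ := FreeProd.lift 0 N₂.incl
  have hΦ : Φ.comp (FreeProd.lift ((FreeProd.inl F L₁ L₂).comp N₁.incl)
      ((FreeProd.inr F L₁ L₂).comp N₂.incl)) = (FreeProd.inr F _ _).comp p := by
    refine FreeProd.hom_ext (fun a => ?_) (fun a => ?_)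
    · have : quotMk N₁ (a : L₁) = 0 := quotMk_eq_zero.mpr a.2
      simp [Φ, p, FreeProd.lift_inl, this]
    · simp [Φ, p, FreeProd.lift_inr]
  have hmem : ⁅FreeProd.inl F L₁ L₂ x, FreeProd.inr F L₁ L₂ y⁆ ∈ N.toLieSubalgebra :=
    lie_mem_right F _ N _ _ (inr_mem hN hy)
  rw [hN] at hmem
  obtain ⟨t, ht⟩ := hmem
  have h₁ : Φ ⁅FreeProd.inl F L₁ L₂ x, FreeProd.inr F L₁ L₂ y⁆ = FreeProd.inr F _ _ (p t) := by
    rw [← ht]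
    exact LieHom.congr_fun hΦ t
  have h₂ : Φ ⁅FreeProd.inl F L₁ L₂ x, FreeProd.inr F L₁ L₂ y⁆ =
      ⁅FreeProd.inl F (L₁ ⧸ N₁) L₂ (quotMk N₁ x), FreeProd.inr F _ _ y⁆ := by
    simp [Φ, FreeProd.lift_inl, FreeProd.lift_inr]
  rw [h₂] at h₁
  have h₃ : p t = 0 := by
    have := congrArg P h₁
    simpa [P, FreeProd.lift_inl, FreeProd.lift_inr] using this.symm
  rw [h₃, map_zero] at h₁
  exact FreeProd.lie_inl_inr_ne_zero (fun h => hx (quotMk_eq_zero.mp h)) hy0 h₁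

end FreeProduct

end Words

/-! ### Spanning set and universal property of the nonabelian tensor product. -/

section Tensor

variable {F : Type u} {L : Type v} {N : Type w} [Field F] [LieRing L] [LieAlgebra F L]
  [LieRing N] [LieAlgebra F N] {φ : L →ₗ⁅F⁆ LieDerivation F N N}
  {ψ : N →ₗ⁅F⁆ LieDerivation F L L}

theorem TensorRelator.quotMk_eq_zero {x : FreeLieAlgebra F (L × N)} (h : TensorRelator φ ψ x) :
    quotMk (tensorIdeal φ ψ) x = 0 :=
  LiePair.quotMk_eq_zero.mpr (LieSubmodule.subset_lieSpan h)

theorem tmul_smul_left (c : F) (l : L) (n : N) : tmul φ ψ (c • l) n = c • tmul φ ψ l n := by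
  have := (TensorRelator.smul_left (φ := φ) (ψ := ψ) c l n).quotMk_eq_zero
  rw [map_sub, map_smul, sub_eq_zero] at this
  exact this.symm

theorem tmul_smul_right (c : F) (l : L) (n : N) : tmul φ ψ l (c • n) = c • tmul φ ψ l n := by
  have := (TensorRelator.smul_right (φ := φ) (ψ := ψ) c l n).quotMk_eq_zero
  rw [map_sub, map_smul, sub_eq_zero] at this
  exact this.symm

theorem tmul_add_left (l l' : L) (n : N) :
    tmul φ ψ (l + l') n = tmul φ ψ l n + tmul φ ψ l' n := by
  have := (TensorRelator.add_left (φ := φ) (ψ := ψ) l l' n).quotMk_eq_zero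
  rw [map_sub, map_add, sub_eq_zero] at this
  exact this

theorem tmul_add_right (l : L) (n n' : N) :
    tmul φ ψ l (n + n') = tmul φ ψ l n + tmul φ ψ l n' := by
  have := (TensorRelator.add_right (φ := φ) (ψ := ψ) l n n').quotMk_eq_zero
  rw [map_sub, map_add, sub_eq_zero] at this
  exact this

theorem tmul_lie_left (l l' : L) (n : N) :
    tmul φ ψ ⁅l, l'⁆ n = tmul φ ψ l (φ l' n) - tmul φ ψ l' (φ l n) := by
  have := (TensorRelator.lie_left (φ := φ) (ψ := ψ) l l' n).quotMk_eq_zero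
  rw [map_sub, map_sub, sub_eq_zero] at this
  exact this

theorem tmul_lie_right (l : L) (n n' : N) :
    tmul φ ψ l ⁅n, n'⁆ = tmul φ ψ (ψ n' l) n - tmul φ ψ (ψ n l) n' := by
  have := (TensorRelator.lie_right (φ := φ) (ψ := ψ) l n n').quotMk_eq_zero
  rw [map_sub, map_sub, sub_eq_zero] at this
  exact this

theorem lie_tmul_tmul (l l' : L) (n n' : N) :
    ⁅tmul φ ψ l n, tmul φ ψ l' n'⁆ = -tmul φ ψ (ψ n l) (φ l' n') := by
  have := (TensorRelator.lie_lie (φ := φ) (ψ := ψ) l l' n n').quotMk_eq_zero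
  rw [map_sub, map_neg, LieHom.map_lie, sub_eq_zero] at this
  exact this

variable (φ ψ) in
/-- The nonabelian tensor as a bilinear map. -/
def tmulₗ : L →ₗ[F] N →ₗ[F] NonabTensor φ ψ :=
  LinearMap.mk₂ F (tmul φ ψ) tmul_add_left tmul_smul_left tmul_add_right tmul_smul_right

@[simp]
theorem tmulₗ_apply (l : L) (n : N) : tmulₗ φ ψ l n = tmul φ ψ l n := rfl

@[simp]
theorem tmul_zero_left (n : N) : tmul φ ψ 0 n = 0 := by
  rw [← tmulₗ_apply, map_zero, LinearMap.zero_apply]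

@[simp]
theorem tmul_zero_right (l : L) : tmul φ ψ l 0 = 0 := by
  rw [← tmulₗ_apply, map_zero]

theorem tmul_neg_left (l : L) (n : N) : tmul φ ψ (-l) n = -tmul φ ψ l n := by
  rw [← tmulₗ_apply, map_neg, LinearMap.neg_apply, tmulₗ_apply]

/-- The nonabelian tensor product is spanned by the generators as a vector space. -/
theorem span_tmul : Submodule.span F {t | ∃ l n, t = tmul φ ψ l n} = ⊤ := by
  let S := Submodule.span F {t | ∃ l n, t = tmul φ ψ l n}
  have hmem (l : L) (n : N) : tmul φ ψ l n ∈ S := Submodule.subset_span ⟨l, n, rfl⟩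
  -- The bracket of two generators is minus a generator, so the linear span is already a subalgebra.
  let K : LieSubalgebra F (NonabTensor φ ψ) :=
    { S with
      lie_mem' := fun {x y} hx hy => by
        refine Submodule.span_induction₂ (p := fun x y _ _ => ⁅x, y⁆ ∈ S) ?_ ?_ ?_ ?_ ?_ ?_ ?_
          hx hy
        · rintro _ _ ⟨l, n, rfl⟩ ⟨l', n', rfl⟩
          rw [lie_tmul_tmul]
          exact S.neg_mem (hmem _ _)
        · intro y _; rw [zero_lie]; exact S.zero_mem
        · intro x _; rw [lie_zero]; exact S.zero_mem
        · intro x y z _ _ _ h h'; rw [add_lie]; exact S.add_mem h h'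
        · intro x y z _ _ _ h h'; rw [lie_add]; exact S.add_mem h h'
        · intro c x y _ _ h; rw [smul_lie]; exact S.smul_mem c h
        · intro c x y _ _ h; rw [lie_smul]; exact S.smul_mem c h }
  let g : FreeLieAlgebra F (L × N) →ₗ⁅F⁆ K :=
    FreeLieAlgebra.lift F fun p => ⟨tmul φ ψ p.1 p.2, hmem _ _⟩
  have hg : K.incl.comp g = quotMk (tensorIdeal φ ψ) :=
    FreeLieAlgebra.hom_ext fun p => by
      simp only [g, LieHom.comp_apply, FreeLieAlgebra.lift_of_apply]
      rfl
  refine eq_top_iff.mpr fun t _ => ?_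
  obtain ⟨t, rfl⟩ := quotMk_surjective _ t
  rw [← hg]
  exact (g t).2

theorem tensor_induction {p : NonabTensor φ ψ → Prop} (t : NonabTensor φ ψ)
    (tmul : ∀ l n, p (tmul φ ψ l n)) (zero : p 0) (add : ∀ x y, p x → p y → p (x + y))
    (smul : ∀ (c : F) x, p x → p (c • x)) : p t := by
  have ht : t ∈ Submodule.span F {t | ∃ l n, t = LiePair.tmul φ ψ l n} := by
    rw [span_tmul]; trivial
  refine Submodule.span_induction ?_ zero (fun x y _ _ => add x y) (fun c x _ => smul c x) ht
  rintro _ ⟨l, n, rfl⟩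
  exact tmul l n

theorem tensor_linearMap_ext {V : Type*} [AddCommGroup V] [Module F V]
    {f g : NonabTensor φ ψ →ₗ[F] V} (h : ∀ l n, f (tmul φ ψ l n) = g (tmul φ ψ l n)) : f = g :=
  LinearMap.ext fun t => tensor_induction (p := fun t => f t = g t) t h (by simp)
    (fun x y hx hy => by rw [map_add, map_add, hx, hy])
    (fun c x hx => by rw [map_smul, map_smul, hx])

theorem subsingleton_tensor_of_left [Subsingleton L] : Subsingleton (NonabTensor φ ψ) :=
  subsingleton_of_forall_eq 0 fun t =>
    tensor_induction (p := fun t => t = 0) t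
      (fun l n => by rw [Subsingleton.elim l 0, tmul_zero_left]) rfl
      (fun x y hx hy => by rw [hx, hy, add_zero]) (fun c x hx => by rw [hx, smul_zero])

theorem subsingleton_tensor_of_right [Subsingleton N] : Subsingleton (NonabTensor φ ψ) :=
  subsingleton_of_forall_eq 0 fun t =>
    tensor_induction (p := fun t => t = 0) t
      (fun l n => by rw [Subsingleton.elim n 0, tmul_zero_right]) rfl
      (fun x y hx hy => by rw [hx, hy, add_zero]) (fun c x hx => by rw [hx, smul_zero])

variable {M : Type z} [LieRing M] [LieAlgebra F M]

variable (φ ψ) in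
/-- The bilinear maps that satisfy the relations of the nonabelian tensor product. -/
structure IsLiePairing (f : L →ₗ[F] N →ₗ[F] M) : Prop where
  lie_left : ∀ l l' n, f ⁅l, l'⁆ n = f l (φ l' n) - f l' (φ l n)
  lie_right : ∀ l n n', f l ⁅n, n'⁆ = f (ψ n' l) n - f (ψ n l) n'
  lie_lie : ∀ l l' n n', ⁅f l n, f l' n'⁆ = -f (ψ n l) (φ l' n')

/-- The universal property of the nonabelian tensor product. -/
def tensorLift (f : L →ₗ[F] N →ₗ[F] M) (hf : IsLiePairing φ ψ f) : NonabTensor φ ψ →ₗ⁅F⁆ M :=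
  quotLift (tensorIdeal φ ψ) (FreeLieAlgebra.lift F fun p : L × N => f p.1 p.2) (by
    rw [tensorIdeal, LieSubmodule.lieSpan_le]
    rintro x hx
    rw [SetLike.mem_coe, LieHom.mem_ker]
    cases hx with
    | smul_left c l n => simp
    | smul_right c l n => simp
    | add_left l l' n => simp
    | add_right l n n' => simp
    | lie_left l l' n => simp [hf.lie_left]
    | lie_right l n n' => simp [hf.lie_right]
    | lie_lie l l' n n' => simp [hf.lie_lie])

@[simp]
theorem tensorLift_tmul (f : L →ₗ[F] N →ₗ[F] M) (hf : IsLiePairing φ ψ f) (l : L) (n : N) :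
    tensorLift f hf (tmul φ ψ l n) = f l n :=
  (quotLift_mk _ _ _ _).trans (by simp)

end Tensor

/-! ### Isomorphisms between ideals. -/

section Restrict

variable {F : Type u} {A : Type v} {B : Type w} [Field F] [LieRing A] [LieAlgebra F A]
  [LieRing B] [LieAlgebra F B]

/-- The restriction of a morphism of Lie algebras to ideals. -/
def restrictIdeal (f : A →ₗ⁅F⁆ B) (I : LieIdeal F A) (J : LieIdeal F B)
    (h : ∀ x ∈ I, f x ∈ J) : I →ₗ⁅F⁆ J where
  toFun x := ⟨f x, h x x.2⟩
  map_add' x y := Subtype.ext (map_add f (x : A) (y : A))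
  map_smul' c x := Subtype.ext (map_smul f c (x : A))
  map_lie' {x y} := Subtype.ext (f.map_lie (x : A) (y : A))

@[simp]
theorem restrictIdeal_coe (f : A →ₗ⁅F⁆ B) (I : LieIdeal F A) (J : LieIdeal F B)
    (h : ∀ x ∈ I, f x ∈ J) (x : I) : (restrictIdeal f I J h x : B) = f x := rfl

theorem nonempty_equiv_of_inverse (f : A →ₗ⁅F⁆ B) (g : B →ₗ⁅F⁆ A) (I : LieIdeal F A)
    (J : LieIdeal F B) (hf : ∀ x ∈ I, f x ∈ J) (hg : ∀ y ∈ J, g y ∈ I)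
    (hgf : ∀ x ∈ I, g (f x) = x) (hfg : ∀ y ∈ J, f (g y) = y) : Nonempty (I ≃ₗ⁅F⁆ J) :=
  ⟨LieEquiv.ofBijective (restrictIdeal f I J hf)
    ⟨fun x y hxy => Subtype.ext (by
      rw [← hgf x x.2, ← hgf y y.2]
      exact congrArg g (congrArg Subtype.val hxy)),
    fun y => ⟨⟨g y, hg y y.2⟩, Subtype.ext (hfg y y.2)⟩⟩⟩

theorem nonempty_equiv_of_subsingleton [Subsingleton A] [Subsingleton B] :
    Nonempty (A ≃ₗ⁅F⁆ B) :=
  ⟨LieEquiv.ofBijective (0 : A →ₗ⁅F⁆ B)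
    ⟨fun _ _ _ => Subsingleton.elim _ _, fun _ => ⟨0, Subsingleton.elim _ _⟩⟩⟩

theorem nonempty_fst_equiv [Subsingleton B] : Nonempty ((A × B) ≃ₗ⁅F⁆ A) :=
  ⟨LieEquiv.ofBijective (LieHom.fst F A B)
    ⟨fun _ _ h => Prod.ext h (Subsingleton.elim _ _), LieHom.fst_surjective⟩⟩

theorem nonempty_snd_equiv [Subsingleton A] : Nonempty ((A × B) ≃ₗ⁅F⁆ B) :=
  ⟨LieEquiv.ofBijective (LieHom.snd F A B)
    ⟨fun _ _ h => Prod.ext (Subsingleton.elim _ _) h, LieHom.snd_surjective⟩⟩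

end Restrict

/-! ### Functoriality of the tensor and exterior products of pairs. -/

section Functoriality

variable {F : Type u} {L : Type v} {L' : Type w} {L'' : Type z} [Field F] [LieRing L]
  [LieAlgebra F L] [LieRing L'] [LieAlgebra F L'] [LieRing L''] [LieAlgebra F L'']
  {N : LieIdeal F L} {N' : LieIdeal F L'} {N'' : LieIdeal F L''}

theorem actOnIdeal_apply_coe (N : LieIdeal F L) (l : L) (n : N) :
    (actOnIdeal N l n : L) = ⁅l, (n : L)⁆ := rfl

/-- The tensor product of pairs is functorial. -/
def pairMap (f : L →ₗ⁅F⁆ L') (h : ∀ x ∈ N, f x ∈ N') : PairTensor N →ₗ⁅F⁆ PairTensor N' :=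
  tensorLift ((tmulₗ (actOnIdeal N') (idealAct N')).compl₁₂ (f : L →ₗ[F] L')
      (restrictIdeal f N N' h : N →ₗ[F] N'))
    { lie_left := fun l l' n => by
        have e (l : L) : restrictIdeal f N N' h (actOnIdeal N l n) =
            actOnIdeal N' (f l) (restrictIdeal f N N' h n) := Subtype.ext (f.map_lie l n)
        simp [tmul_lie_left, e]
      lie_right := fun l n n' => by
        have e (n : N) : f (idealAct N n l) = idealAct N' (restrictIdeal f N N' h n) (f l) := by
          simp [idealAct_apply]
        simp only [LinearMap.compl₁₂_apply, LieHom.coe_toLinearMap, tmulₗ_apply, e]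
        rw [LieHom.map_lie, tmul_lie_right]
      lie_lie := fun l l' n n' => by
        have e₁ (l : L) : restrictIdeal f N N' h (actOnIdeal N l n') =
            actOnIdeal N' (f l) (restrictIdeal f N N' h n') := Subtype.ext (f.map_lie l n')
        have e₂ (n : N) : f (idealAct N n l) = idealAct N' (restrictIdeal f N N' h n) (f l) := by
          simp [idealAct_apply]
        simp [lie_tmul_tmul, e₁, e₂] }

@[simp]
theorem pairMap_tmul (f : L →ₗ⁅F⁆ L') (h : ∀ x ∈ N, f x ∈ N') (l : L) (n : N) :
    pairMap f h (tmul (actOnIdeal N) (idealAct N) l n) =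
      tmul (actOnIdeal N') (idealAct N') (f l) ⟨f n, h n n.2⟩ :=
  tensorLift_tmul _ _ _ _

theorem pairMap_pairMap_eq_self (f : L →ₗ⁅F⁆ L') (h : ∀ x ∈ N, f x ∈ N') (g : L' →ₗ⁅F⁆ L)
    (h' : ∀ x ∈ N', g x ∈ N) (hgf : ∀ x, g (f x) = x) (t : PairTensor N) :
    pairMap g h' (pairMap f h t) = t := by
  have : (pairMap g h' : PairTensor N' →ₗ[F] PairTensor N) ∘ₗ
      (pairMap f h : PairTensor N →ₗ[F] PairTensor N') = LinearMap.id :=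
    tensor_linearMap_ext fun l n => by simp [hgf]
  exact LinearMap.congr_fun this t

theorem pairMap_pairMap_eq_zero (f : L →ₗ⁅F⁆ L') (h : ∀ x ∈ N, f x ∈ N') (g : L' →ₗ⁅F⁆ L'')
    (h' : ∀ x ∈ N', g x ∈ N'') (hgf : ∀ x, g (f x) = 0) (t : PairTensor N) :
    pairMap g h' (pairMap f h t) = 0 := by
  have : (pairMap g h' : PairTensor N' →ₗ[F] PairTensor N'') ∘ₗ
      (pairMap f h : PairTensor N →ₗ[F] PairTensor N') = 0 :=
    tensor_linearMap_ext fun l n => by simp [hgf]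
  exact LinearMap.congr_fun this t

theorem kappa_pairMap (f : L →ₗ⁅F⁆ L') (h : ∀ x ∈ N, f x ∈ N') (t : PairTensor N) :
    kappa N' (pairMap f h t) = f (kappa N t) := by
  have : (kappa N' : PairTensor N' →ₗ[F] L') ∘ₗ
      (pairMap f h : PairTensor N →ₗ[F] PairTensor N') =
      (f : L →ₗ[F] L') ∘ₗ (kappa N : PairTensor N →ₗ[F] L) :=
    tensor_linearMap_ext fun l n => by simp [kappa_tmul]
  exact LinearMap.congr_fun this t

theorem mem_J₂ {t : PairTensor N} : t ∈ J₂ N ↔ kappa N t = 0 := LieHom.mem_ker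

theorem pairMap_mem_J₂ (f : L →ₗ⁅F⁆ L') (h : ∀ x ∈ N, f x ∈ N') {t : PairTensor N}
    (ht : t ∈ J₂ N) : pairMap f h t ∈ J₂ N' := by
  rw [mem_J₂] at ht ⊢
  rw [kappa_pairMap, ht, map_zero]

theorem tmul_self_mem_diagonal (n : N) :
    tmul (actOnIdeal N) (idealAct N) (n : L) n ∈ diagonal N :=
  LieSubmodule.subset_lieSpan ⟨n, rfl⟩

/-- The diagonal is central, hence spanned by the elements `n ⊗ n` as a vector space. -/
theorem diagonal_eq_span : (diagonal N).toSubmodule =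
    Submodule.span F {t | ∃ n : N, t = tmul (actOnIdeal N) (idealAct N) (n : L) n} := by
  apply le_antisymm
  · let S : LieIdeal F (PairTensor N) :=
      { Submodule.span F {t | ∃ n : N, t = tmul (actOnIdeal N) (idealAct N) (n : L) n} with
        lie_mem := fun {x m} hm => by
          have : ⁅x, m⁆ = 0 := by
            refine Submodule.span_induction (p := fun m _ => ⁅x, m⁆ = 0) ?_ (lie_zero x)
              (fun m m' _ _ h h' => by rw [lie_add, h, h', add_zero])
              (fun c m _ h => by rw [lie_smul, h, smul_zero]) hm
            rintro _ ⟨n, rfl⟩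
            -- Centrality holds because the bracket of `n ⊗ n` with `l ⊗ n'` has `[n, n] = 0` as its
            -- left entry.
            rw [← lie_skew, neg_eq_zero]
            refine tensor_induction (p := fun x => ⁅tmul (actOnIdeal N) (idealAct N) (n : L) n, x⁆
              = 0) x (fun l n' => ?_) (lie_zero _)
              (fun m m' h h' => by rw [lie_add, h, h', add_zero])
              (fun c m h => by rw [lie_smul, h, smul_zero])
            rw [lie_tmul_tmul, idealAct_apply, lie_self, tmul_zero_left, neg_zero]
          rw [this]
          exact Submodule.zero_mem _ }
    exact (LieSubmodule.lieSpan_le (N := S)).mpr Submodule.subset_span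
  · rw [Submodule.span_le]
    rintro _ ⟨n, rfl⟩
    exact tmul_self_mem_diagonal n

theorem pairMap_mem_diagonal (f : L →ₗ⁅F⁆ L') (h : ∀ x ∈ N, f x ∈ N') {t : PairTensor N}
    (ht : t ∈ diagonal N) : pairMap f h t ∈ diagonal N' := by
  have : diagonal N ≤ LieIdeal.comap (pairMap f h) (diagonal N') := by
    refine LieSubmodule.lieSpan_le.mpr ?_
    rintro _ ⟨n, rfl⟩
    rw [SetLike.mem_coe, LieIdeal.mem_comap, pairMap_tmul]
    exact tmul_self_mem_diagonal (N := N') ⟨f n, h n n.2⟩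
  exact this ht

/-- The exterior product of pairs is functorial. -/
def pairExtMap (f : L →ₗ⁅F⁆ L') (h : ∀ x ∈ N, f x ∈ N') : PairExterior N →ₗ⁅F⁆ PairExterior N' :=
  quotLift (diagonal N) ((quotMk (diagonal N')).comp (pairMap f h)) fun t ht => by
    rw [LieHom.mem_ker, LieHom.comp_apply, quotMk_eq_zero]
    exact pairMap_mem_diagonal f h ht

theorem pairExtMap_quotMk (f : L →ₗ⁅F⁆ L') (h : ∀ x ∈ N, f x ∈ N') (t : PairTensor N) :
    pairExtMap f h (quotMk (diagonal N) t) = quotMk (diagonal N') (pairMap f h t) := rfl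

theorem pairExtMap_pairExtMap_eq_self (f : L →ₗ⁅F⁆ L') (h : ∀ x ∈ N, f x ∈ N')
    (g : L' →ₗ⁅F⁆ L) (h' : ∀ x ∈ N', g x ∈ N) (hgf : ∀ x, g (f x) = x) (t : PairExterior N) :
    pairExtMap g h' (pairExtMap f h t) = t := by
  obtain ⟨t, rfl⟩ := quotMk_surjective _ t
  rw [pairExtMap_quotMk, pairExtMap_quotMk, pairMap_pairMap_eq_self _ _ _ _ hgf]

theorem pairExtMap_pairExtMap_eq_zero (f : L →ₗ⁅F⁆ L') (h : ∀ x ∈ N, f x ∈ N')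
    (g : L' →ₗ⁅F⁆ L'') (h' : ∀ x ∈ N', g x ∈ N'') (hgf : ∀ x, g (f x) = 0)
    (t : PairExterior N) : pairExtMap g h' (pairExtMap f h t) = 0 := by
  obtain ⟨t, rfl⟩ := quotMk_surjective _ t
  rw [pairExtMap_quotMk, pairExtMap_quotMk, pairMap_pairMap_eq_zero _ _ _ _ hgf, map_zero]

theorem kappa'_quotMk (t : PairTensor N) : kappa' N (quotMk (diagonal N) t) = kappa N t := rfl

theorem mem_schurMultiplier {t : PairExterior N} : t ∈ schurMultiplier N ↔ kappa' N t = 0 :=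
  LieHom.mem_ker

theorem pairExtMap_mem_schurMultiplier (f : L →ₗ⁅F⁆ L') (h : ∀ x ∈ N, f x ∈ N')
    {t : PairExterior N} (ht : t ∈ schurMultiplier N) : pairExtMap f h t ∈ schurMultiplier N' := by
  obtain ⟨t, rfl⟩ := quotMk_surjective _ t
  rw [mem_schurMultiplier, kappa'_quotMk] at ht
  rw [mem_schurMultiplier, pairExtMap_quotMk, kappa'_quotMk, kappa_pairMap, ht, map_zero]

theorem nonempty_J₂_equiv (f : L →ₗ⁅F⁆ L') (g : L' →ₗ⁅F⁆ L)
    (hf : ∀ x ∈ N, f x ∈ N') (hg : ∀ x ∈ N', g x ∈ N) (hgf : ∀ x, g (f x) = x)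
    (hfg : ∀ y, f (g y) = y) :
    Nonempty (J₂ N ≃ₗ⁅F⁆ J₂ N') :=
  nonempty_equiv_of_inverse (pairMap f hf) (pairMap g hg) _ _ (fun _ => pairMap_mem_J₂ f hf)
    (fun _ => pairMap_mem_J₂ g hg)
    (fun t _ => pairMap_pairMap_eq_self _ _ _ _ hgf t)
    (fun t _ => pairMap_pairMap_eq_self _ _ _ _ hfg t)

theorem nonempty_diagonal_equiv (f : L →ₗ⁅F⁆ L') (g : L' →ₗ⁅F⁆ L)
    (hf : ∀ x ∈ N, f x ∈ N') (hg : ∀ x ∈ N', g x ∈ N) (hgf : ∀ x, g (f x) = x)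
    (hfg : ∀ y, f (g y) = y) :
    Nonempty (diagonal N ≃ₗ⁅F⁆ diagonal N') :=
  nonempty_equiv_of_inverse (pairMap f hf) (pairMap g hg) _ _
    (fun _ => pairMap_mem_diagonal f hf) (fun _ => pairMap_mem_diagonal g hg)
    (fun t _ => pairMap_pairMap_eq_self _ _ _ _ hgf t)
    (fun t _ => pairMap_pairMap_eq_self _ _ _ _ hfg t)

theorem nonempty_schurMultiplier_equiv (f : L →ₗ⁅F⁆ L') (g : L' →ₗ⁅F⁆ L)
    (hf : ∀ x ∈ N, f x ∈ N') (hg : ∀ x ∈ N', g x ∈ N) (hgf : ∀ x, g (f x) = x)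
    (hfg : ∀ y, f (g y) = y) :
    Nonempty (schurMultiplier N ≃ₗ⁅F⁆ schurMultiplier N') :=
  nonempty_equiv_of_inverse (pairExtMap f hf) (pairExtMap g hg) _ _
    (fun _ => pairExtMap_mem_schurMultiplier f hf) (fun _ => pairExtMap_mem_schurMultiplier g hg)
    (fun t _ => pairExtMap_pairExtMap_eq_self _ _ _ _ hgf t)
    (fun t _ => pairExtMap_pairExtMap_eq_self _ _ _ _ hfg t)

section Bot

variable [Subsingleton N]

theorem subsingleton_pairTensor : Subsingleton (PairTensor N) := subsingleton_tensor_of_right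

theorem subsingleton_J₂ : Subsingleton (J₂ N) :=
  have := subsingleton_pairTensor (N := N)
  inferInstance

theorem subsingleton_diagonal : Subsingleton (diagonal N) :=
  have := subsingleton_pairTensor (N := N)
  inferInstance

theorem subsingleton_schurMultiplier : Subsingleton (schurMultiplier N) :=
  have := subsingleton_pairTensor (N := N)
  have : Subsingleton (PairExterior N) := (quotMk_surjective (diagonal N)).subsingleton
  inferInstance

theorem subsingleton_coinv : Subsingleton (Coinv N) :=
  (quotMk_surjective (LieIdeal.comap N.incl ⁅N, (⊤ : LieIdeal F L)⁆)).subsingleton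

end Bot

end Functoriality

/-! ### The tensor square: skew symmetry modulo the derived subalgebra. -/

section SelfTensor

variable {F : Type u} {L : Type v} {L' : Type w} [Field F] [LieRing L] [LieAlgebra F L]
  [LieRing L'] [LieAlgebra F L']

variable (F L) in
/-- The nonabelian tensor square of `L`. -/
abbrev SelfTensor : Type _ := PairTensor (⊤ : LieIdeal F L)

variable (F L) in
/-- The derived subalgebra of `L`. -/
abbrev derived : LieIdeal F L := ⁅(⊤ : LieIdeal F L), (⊤ : LieIdeal F L)⁆

variable (F L) in
/-- The identity of `L` as a morphism to its largest ideal. -/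
def toTop : L →ₗ⁅F⁆ (⊤ : LieIdeal F L) where
  toFun x := ⟨x, LieSubmodule.mem_top x⟩
  map_add' _ _ := rfl
  map_smul' _ _ := rfl
  map_lie' := rfl

variable (F) in
/-- The generators of the nonabelian tensor square, as a bilinear map on `L`. -/
def selfTmul : L →ₗ[F] L →ₗ[F] SelfTensor F L :=
  (tmulₗ (actOnIdeal ⊤) (idealAct ⊤)).compl₂ (toTop F L : L →ₗ[F] (⊤ : LieIdeal F L))

theorem selfTmul_lie_left (x y z : L) :
    selfTmul F ⁅x, y⁆ z = selfTmul F x ⁅y, z⁆ - selfTmul F y ⁅x, z⁆ :=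
  tmul_lie_left x y _

theorem selfTmul_lie_right (x y z : L) :
    selfTmul F x ⁅y, z⁆ = selfTmul F ⁅z, x⁆ y - selfTmul F ⁅y, x⁆ z := by
  have := tmul_lie_right (φ := actOnIdeal (⊤ : LieIdeal F L)) (ψ := idealAct ⊤) x
    ⟨y, LieSubmodule.mem_top y⟩ ⟨z, LieSubmodule.mem_top z⟩
  rw [idealAct_apply, idealAct_apply] at this
  exact this

theorem lie_selfTmul (x y z w : L) :
    ⁅selfTmul F x y, selfTmul F z w⁆ = selfTmul F ⁅x, y⁆ ⁅z, w⁆ := by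
  have := lie_tmul_tmul (φ := actOnIdeal (⊤ : LieIdeal F L)) (ψ := idealAct ⊤) x z
    ⟨y, LieSubmodule.mem_top y⟩ ⟨w, LieSubmodule.mem_top w⟩
  rw [idealAct_apply, ← tmul_neg_left, lie_skew] at this
  exact this

theorem kappa_selfTmul (x y : L) : kappa ⊤ (selfTmul F x y) = ⁅x, y⁆ := kappa_tmul _ _ _

theorem selfTensor_linearMap_ext {V : Type*} [AddCommGroup V] [Module F V]
    {f g : SelfTensor F L →ₗ[F] V} (h : ∀ x y, f (selfTmul F x y) = g (selfTmul F x y)) : f = g :=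
  tensor_linearMap_ext fun l n => h l n

/-- Expanding `[a, b] ⊗ x` by the left relation, and each resulting term by the right relation,
gives `2 [a, b] ⊗ x` plus the right expansion of `x ⊗ [a, b]`. -/
theorem selfTmul_lie_skew (x a b : L) : selfTmul F x ⁅a, b⁆ = -selfTmul F ⁅a, b⁆ x := by
  have h₁ := selfTmul_lie_right (F := F) x a b
  have h₂ := selfTmul_lie_left (F := F) a b x
  have h₃ := selfTmul_lie_right (F := F) a b x
  have h₄ := selfTmul_lie_right (F := F) b a x
  rw [← lie_skew b a, map_neg, LinearMap.neg_apply] at h₃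
  rw [← lie_skew x b, map_neg, LinearMap.neg_apply] at h₄
  rw [← lie_skew a x, map_neg, LinearMap.neg_apply] at h₁
  linear_combination (norm := module) h₁ - h₂ - h₃ + h₄

theorem mem_derived_iff (x : L) :
    x ∈ derived F L ↔ x ∈ Submodule.span F {z : L | ∃ x y : L, ⁅x, y⁆ = z} := by
  rw [← LieSubmodule.mem_toSubmodule, LieSubmodule.lieIdeal_oper_eq_linear_span']
  simp

theorem lie_mem_derived (x y : L) : ⁅x, y⁆ ∈ derived F L :=
  LieSubmodule.lie_mem_lie (LieSubmodule.mem_top x) (LieSubmodule.mem_top y)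

theorem map_mem_derived (f : L →ₗ⁅F⁆ L') {x : L} (hx : x ∈ derived F L) : f x ∈ derived F L' := by
  rw [mem_derived_iff] at hx
  refine Submodule.span_induction (p := fun x _ => f x ∈ derived F L') ?_ (by simp)
    (fun x y _ _ hx hy => by rw [map_add]; exact add_mem hx hy)
    (fun c x _ hx => by rw [map_smul]; exact (derived F L').smul_mem c hx) hx
  rintro _ ⟨x, y, rfl⟩
  rw [LieHom.map_lie]
  exact lie_mem_derived _ _

theorem selfTmul_skew_of_mem_derived (x : L) {c : L} (hc : c ∈ derived F L) :
    selfTmul F x c = -selfTmul F c x := by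
  rw [mem_derived_iff] at hc
  refine Submodule.span_induction (p := fun c _ => selfTmul F x c = -selfTmul F c x) ?_ (by simp)
    (fun c d _ _ hc hd => by rw [map_add, map_add, hc, hd, LinearMap.add_apply]; abel)
    (fun k c _ hc => by rw [map_smul, map_smul, hc, LinearMap.smul_apply, smul_neg]) hc
  rintro _ ⟨a, b, rfl⟩
  exact selfTmul_lie_skew x a b

/-- For one commutator, `[a, b] ⊗ [a, b]` is the bracket of `a ⊗ b` with itself. Cross terms between
summands cancel by skew symmetry, so no division by two is needed. -/
theorem selfTmul_self_of_mem_derived {c : L} (hc : c ∈ derived F L) : selfTmul F c c = 0 := by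
  rw [mem_derived_iff] at hc
  refine Submodule.span_induction (p := fun c _ => selfTmul F c c = 0) ?_ (by simp)
    (fun c d _ hd hc' hd' => ?_)
    (fun k c _ hc => by rw [map_smul, map_smul, LinearMap.smul_apply, hc, smul_zero, smul_zero]) hc
  · rintro _ ⟨a, b, rfl⟩
    rw [← lie_selfTmul, lie_self]
  · rw [map_add, map_add, LinearMap.add_apply, LinearMap.add_apply, hc', hd',
      selfTmul_skew_of_mem_derived c ((mem_derived_iff d).mpr hd)]
    abel

/-- The diagonal thus depends only on the abelianization. This drives the isomorphism of diagonals
and isolates the mixed summand of `J₂`. -/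
theorem selfTmul_self_congr {x y : L} (h : x - y ∈ derived F L) :
    selfTmul F x x = selfTmul F y y := by
  obtain ⟨c, hc, rfl⟩ : ∃ c ∈ derived F L, x = y + c := ⟨x - y, h, by abel⟩
  rw [map_add, map_add, LinearMap.add_apply, LinearMap.add_apply,
    selfTmul_self_of_mem_derived hc, selfTmul_skew_of_mem_derived y hc]
  abel

variable (F L) in
/-- The symmetrised generators `x ⊗ y + y ⊗ x`. -/
def symTmul : L →ₗ[F] L →ₗ[F] SelfTensor F L := selfTmul F + (selfTmul F).flip

theorem symTmul_apply (x y : L) : symTmul F L x y = selfTmul F x y + selfTmul F y x := rfl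

theorem symTmul_comm (x y : L) : symTmul F L x y = symTmul F L y x := by
  rw [symTmul_apply, symTmul_apply, add_comm]

theorem symTmul_of_mem_derived_right (x : L) {c : L} (hc : c ∈ derived F L) :
    symTmul F L x c = 0 := by
  rw [symTmul_apply, selfTmul_skew_of_mem_derived x hc, neg_add_cancel]

theorem symTmul_congr {x x' y y' : L} (hx : x - x' ∈ derived F L) (hy : y - y' ∈ derived F L) :
    symTmul F L x y = symTmul F L x' y' := by
  have h₁ := symTmul_of_mem_derived_right y hx
  have h₂ := symTmul_of_mem_derived_right x' hy
  rw [symTmul_comm, map_sub, LinearMap.sub_apply, sub_eq_zero] at h₁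
  rw [map_sub, sub_eq_zero] at h₂
  rw [h₁, h₂]

/-- The left entries of the expanded brackets are `[x, y]` and `[y, x]`, which cancel. This allows
an abelian algebra to map onto the symmetrised elements. -/
theorem lie_symTmul (x y z w : L) : ⁅symTmul F L x y, symTmul F L z w⁆ = 0 := by
  rw [symTmul_apply, add_lie, symTmul_apply]
  simp only [lie_add, lie_selfTmul]
  rw [← lie_skew x y, map_neg]
  simp only [LinearMap.neg_apply]
  abel

theorem kappa_symTmul (x y : L) : kappa ⊤ (symTmul F L x y) = 0 := by
  rw [symTmul_apply, map_add, kappa_selfTmul, kappa_selfTmul, ← lie_skew, neg_add_cancel]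

/-- The map of tensor squares induced by a morphism. -/
def selfMap (f : L →ₗ⁅F⁆ L') : SelfTensor F L →ₗ⁅F⁆ SelfTensor F L' :=
  pairMap f fun _ _ => LieSubmodule.mem_top _

@[simp]
theorem selfMap_selfTmul (f : L →ₗ⁅F⁆ L') (x y : L) :
    selfMap f (selfTmul F x y) = selfTmul F (f x) (f y) :=
  pairMap_tmul _ _ _ _

theorem selfMap_symTmul (f : L →ₗ⁅F⁆ L') (x y : L) :
    selfMap f (symTmul F L x y) = symTmul F L' (f x) (f y) := by
  simp [symTmul_apply]

theorem selfTmul_self_mem_diagonal (x : L) : selfTmul F x x ∈ diagonal (⊤ : LieIdeal F L) :=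
  tmul_self_mem_diagonal (N := ⊤) ⟨x, LieSubmodule.mem_top x⟩

theorem selfTmul_self_mem_J₂ (x : L) : selfTmul F x x ∈ J₂ (⊤ : LieIdeal F L) := by
  rw [mem_J₂, kappa_selfTmul, lie_self]

theorem diagonal_top_eq_span : (diagonal (⊤ : LieIdeal F L)).toSubmodule =
    Submodule.span F (Set.range fun x : L => selfTmul F x x) := by
  rw [diagonal_eq_span]
  congr 1
  ext t
  exact ⟨fun ⟨n, h⟩ => ⟨n, h.symm⟩, fun ⟨x, h⟩ => ⟨⟨x, LieSubmodule.mem_top x⟩, h.symm⟩⟩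

end SelfTensor

/-! ### Linear maps out of the tensor square that kill commutators. -/

section Trivial

/-- A vector space regarded as an abelian Lie algebra. -/
def TrivialLie (V : Type*) : Type _ := V

variable {F : Type u} {L : Type v} {V : Type w} [Field F] [LieRing L] [LieAlgebra F L]
  [AddCommGroup V] [Module F V]

instance : AddCommGroup (TrivialLie V) := inferInstanceAs (AddCommGroup V)

instance : LieRing (TrivialLie V) where
  bracket _ _ := 0
  add_lie _ _ _ := (add_zero 0).symm
  lie_add _ _ _ := (add_zero 0).symm
  lie_self _ := rfl
  leibniz_lie _ _ _ := (add_zero 0).symm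

instance : Module F (TrivialLie V) := inferInstanceAs (Module F V)

instance : LieAlgebra F (TrivialLie V) where
  lie_smul c _ _ := (smul_zero (A := TrivialLie V) c).symm

variable (F V) in
/-- The identity map from a vector space to the abelian Lie algebra on it. -/
def TrivialLie.equiv : V ≃ₗ[F] TrivialLie V := LinearEquiv.refl F V

/-- A bilinear map that kills commutators factors linearly through the tensor square. -/
theorem exists_linearMap_selfTmul (f : L →ₗ[F] L →ₗ[F] V) (h₁ : ∀ x y z : L, f ⁅x, y⁆ z = 0)
    (h₂ : ∀ x y z : L, f x ⁅y, z⁆ = 0) :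
    ∃ e : SelfTensor F L →ₗ[F] V, ∀ x y, e (selfTmul F x y) = f x y := by
  let f' : L →ₗ[F] (⊤ : LieIdeal F L) →ₗ[F] TrivialLie V :=
    (f.compl₂ ((⊤ : LieIdeal F L).toSubmodule.subtype)).compr₂
      (TrivialLie.equiv F V : V →ₗ[F] TrivialLie V)
  have hf' : IsLiePairing (actOnIdeal ⊤) (idealAct ⊤) f' :=
    { lie_left := fun l l' n => by
        change f ⁅l, l'⁆ (n : L) = f l ⁅l', (n : L)⁆ - f l' ⁅l, (n : L)⁆
        rw [h₁, h₂, h₂, sub_zero]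
      lie_right := fun l n n' => by
        rw [idealAct_apply, idealAct_apply]
        change f l ⁅(n : L), (n' : L)⁆ = f ⁅(n' : L), l⁆ n - f ⁅(n : L), l⁆ n'
        rw [h₁, h₁, h₂, sub_zero]
      lie_lie := fun l l' n n' => by
        change (0 : V) = -f (idealAct ⊤ n l) ⁅l', (n' : L)⁆
        rw [h₂, neg_zero] }
  exact ⟨((TrivialLie.equiv F V).symm : TrivialLie V →ₗ[F] V) ∘ₗ
    (tensorLift f' hf' : SelfTensor F L →ₗ[F] TrivialLie V), fun x y =>
    tensorLift_tmul f' hf' x ⟨y, LieSubmodule.mem_top y⟩⟩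

end Trivial

/-! ### The abelianization and its linear sections. -/

section Abelianization

variable {F : Type u} {L : Type v} [Field F] [LieRing L] [LieAlgebra F L]

variable (F L) in
/-- The projection of `L` onto its abelianization. -/
def abMk : L →ₗ⁅F⁆ Coinv (⊤ : LieIdeal F L) :=
  (quotMk _).comp (toTop F L)

theorem abMk_surjective : Function.Surjective (abMk F L) := fun t => by
  obtain ⟨x, rfl⟩ := quotMk_surjective _ t
  exact ⟨x, rfl⟩

theorem abMk_eq_zero {x : L} : abMk F L x = 0 ↔ x ∈ derived F L :=
  quotMk_eq_zero.trans LieIdeal.mem_comap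

theorem abMk_lie (x y : L) : abMk F L ⁅x, y⁆ = 0 := abMk_eq_zero.mpr (lie_mem_derived x y)

theorem lie_coinv_eq_zero (s t : Coinv (⊤ : LieIdeal F L)) : ⁅s, t⁆ = 0 := by
  obtain ⟨x, rfl⟩ := abMk_surjective s
  obtain ⟨y, rfl⟩ := abMk_surjective t
  rw [← LieHom.map_lie, abMk_lie]

theorem exists_abMk_section : ∃ s : Coinv (⊤ : LieIdeal F L) →ₗ[F] L,
    ∀ x, s (abMk F L x) - x ∈ derived F L := by
  obtain ⟨s, hs⟩ := (abMk F L : L →ₗ[F] Coinv (⊤ : LieIdeal F L)).exists_rightInverse_of_surjective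
    (LinearMap.range_eq_top.mpr abMk_surjective)
  refine ⟨s, fun x => abMk_eq_zero.mp ?_⟩
  rw [map_sub, sub_eq_zero]
  exact LinearMap.congr_fun hs (abMk F L x)

end Abelianization

/-! ### Central extensions attached to two-cocycles. -/

section CocycleExtension

variable {F : Type u} {L : Type v} {Q : Type w} [Field F] [LieRing L] [LieAlgebra F L]
  [AddCommGroup Q] [Module F Q]

/-- A two-cocycle on `L` with values in the trivial module `Q`. -/
structure IsCocycle (ω : L →ₗ[F] L →ₗ[F] Q) : Prop where
  self : ∀ x, ω x x = 0
  leibniz : ∀ x y z, ω x ⁅y, z⁆ = ω ⁅x, y⁆ z + ω y ⁅x, z⁆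

/-- The central extension of `L` by `Q` that belongs to a cocycle. -/
def CocycleExt {ω : L →ₗ[F] L →ₗ[F] Q} (_ : IsCocycle ω) : Type _ := L × Q

variable {ω : L →ₗ[F] L →ₗ[F] Q} {hω : IsCocycle ω}

instance : AddCommGroup (CocycleExt hω) := inferInstanceAs (AddCommGroup (L × Q))

instance : LieRing (CocycleExt hω) where
  bracket x y := (⁅x.1, y.1⁆, ω x.1 y.1)
  add_lie x y z := Prod.ext (add_lie x.1 y.1 z.1) (by
    change ω (x.1 + y.1) z.1 = ω x.1 z.1 + ω y.1 z.1
    rw [map_add, LinearMap.add_apply])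
  lie_add x y z := Prod.ext (lie_add x.1 y.1 z.1) (map_add (ω x.1) y.1 z.1)
  lie_self x := Prod.ext (lie_self x.1) (hω.self x.1)
  leibniz_lie x y z := Prod.ext (leibniz_lie x.1 y.1 z.1) (hω.leibniz x.1 y.1 z.1)

instance : LieAlgebra F (CocycleExt hω) where
  toModule := inferInstanceAs (Module F (L × Q))
  lie_smul c x y := Prod.ext (lie_smul c x.1 y.1) (map_smul (ω x.1) c y.1)

variable (hω) in
/-- The projection of the central extension. -/
def CocycleExt.fst : CocycleExt hω →ₗ⁅F⁆ L where
  toFun := Prod.fst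
  map_add' _ _ := rfl
  map_smul' _ _ := rfl
  map_lie' := rfl

variable (hω) in
/-- The second coordinate of the central extension. -/
def CocycleExt.snd : CocycleExt hω →ₗ[F] Q where
  toFun := Prod.snd
  map_add' _ _ := rfl
  map_smul' _ _ := rfl

variable (hω) in
/-- A morphism into the central extension. -/
def CocycleExt.mk {A : Type*} [LieRing A] [LieAlgebra F A] (f : A →ₗ⁅F⁆ L) (μ : A →ₗ[F] Q)
    (h : ∀ x y, μ ⁅x, y⁆ = ω (f x) (f y)) : A →ₗ⁅F⁆ CocycleExt hω where
  toFun x := (f x, μ x)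
  map_add' x y := Prod.ext (map_add f x y) (map_add μ x y)
  map_smul' c x := Prod.ext (map_smul f c x) (map_smul μ c x)
  map_lie' {x y} := Prod.ext (f.map_lie x y) (h x y)

end CocycleExtension

/-! ### Splitting over a free product and the bound on `J₂`. -/

section FreeProduct

variable {F : Type u} {L₁ : Type v} {L₂ : Type w} [Field F] [LieRing L₁] [LieAlgebra F L₁]
  [LieRing L₂] [LieAlgebra F L₂]

/-- A two-cocycle on a free product that is a coboundary on both factors is a coboundary. -/
theorem FreeProd.exists_primitive {Q : Type*} [AddCommGroup Q] [Module F Q]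
    {ω : FreeProd F L₁ L₂ →ₗ[F] FreeProd F L₁ L₂ →ₗ[F] Q} (hω : IsCocycle ω)
    (μ₁ : L₁ →ₗ[F] Q) (h₁ : ∀ x y, μ₁ ⁅x, y⁆ = ω (FreeProd.inl F L₁ L₂ x) (FreeProd.inl F L₁ L₂ y))
    (μ₂ : L₂ →ₗ[F] Q)
    (h₂ : ∀ x y, μ₂ ⁅x, y⁆ = ω (FreeProd.inr F L₁ L₂ x) (FreeProd.inr F L₁ L₂ y)) :
    ∃ μ : FreeProd F L₁ L₂ →ₗ[F] Q, ∀ x y, μ ⁅x, y⁆ = ω x y := by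
  -- Each primitive `μᵢ` lifts a factor into the central extension. The universal property joins the
  -- lifts to a section, whose second coordinate is the desired primitive.
  let σ : FreeProd F L₁ L₂ →ₗ⁅F⁆ CocycleExt hω :=
    FreeProd.lift (CocycleExt.mk hω _ μ₁ h₁) (CocycleExt.mk hω _ μ₂ h₂)
  have hσ : (CocycleExt.fst hω).comp σ = LieHom.id :=
    FreeProd.hom_ext (fun x => by simp only [σ, LieHom.comp_apply, FreeProd.lift_inl]; rfl)
      (fun x => by simp only [σ, LieHom.comp_apply, FreeProd.lift_inr]; rfl)
  have hσ' (x) : (σ x).1 = x := LieHom.congr_fun hσ x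
  refine ⟨CocycleExt.snd hω ∘ₗ (σ : FreeProd F L₁ L₂ →ₗ[F] CocycleExt hω), fun x y => ?_⟩
  change (σ ⁅x, y⁆).2 = ω x y
  rw [LieHom.map_lie]
  change ω (σ x).1 (σ y).1 = ω x y
  rw [hσ', hσ']

theorem exists_comp_eq_of_ker_le {A B C : Type*} [AddCommGroup A] [Module F A] [AddCommGroup B]
    [Module F B] [AddCommGroup C] [Module F C] (f : A →ₗ[F] B) (g : A →ₗ[F] C)
    (h : ∀ x, f x = 0 → g x = 0) : ∃ k : B →ₗ[F] C, ∀ x, k (f x) = g x := by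
  obtain ⟨s, hs⟩ := f.rangeRestrict.exists_rightInverse_of_surjective f.range_rangeRestrict
  obtain ⟨k, hk⟩ := (g ∘ₗ s).exists_extend
  refine ⟨k, fun x => ?_⟩
  have h₁ : k (f x) = g (s (f.rangeRestrict x)) := LinearMap.congr_fun hk (f.rangeRestrict x)
  have h₂ : f (s (f.rangeRestrict x)) = f x :=
    congrArg Subtype.val (LinearMap.congr_fun hs (f.rangeRestrict x))
  rw [h₁, ← sub_eq_zero, ← map_sub]
  exact h _ (by rw [map_sub, h₂, sub_self])

/-- `J₂` of a free product lies in every subspace that contains the diagonal elements and the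
images of `J₂` of the factors. -/
theorem J₂_freeProd_le (C : Submodule F (SelfTensor F (FreeProd F L₁ L₂)))
    (h₀ : ∀ x, selfTmul F x x ∈ C)
    (h₁ : ∀ t ∈ J₂ (⊤ : LieIdeal F L₁), selfMap (FreeProd.inl F L₁ L₂) t ∈ C)
    (h₂ : ∀ t ∈ J₂ (⊤ : LieIdeal F L₂), selfMap (FreeProd.inr F L₁ L₂) t ∈ C) :
    (J₂ (⊤ : LieIdeal F (FreeProd F L₁ L₂))).toSubmodule ≤ C := by
  -- The tensor modulo `C` alternates because `C` contains every `x ⊗ x`, and it satisfies the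
  -- cocycle identity by the left relation.
  let ω : FreeProd F L₁ L₂ →ₗ[F] FreeProd F L₁ L₂ →ₗ[F] _ := (selfTmul F).compr₂ C.mkQ
  have hω : IsCocycle ω :=
    { self := fun x => (Submodule.Quotient.mk_eq_zero C).mpr (h₀ x)
      leibniz := fun x y z => by
        simp only [ω, LinearMap.compr₂_apply, selfTmul_lie_left, map_sub, sub_add_cancel] }
  -- On a factor the quotient map kills `J₂`, the kernel of `κ`, and so factors linearly through
  -- `κ`; the factor map is a primitive.
  obtain ⟨μ₁, hμ₁⟩ := exists_comp_eq_of_ker_le (kappa (⊤ : LieIdeal F L₁) : _ →ₗ[F] L₁)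
    (C.mkQ ∘ₗ (selfMap (FreeProd.inl F L₁ L₂) : _ →ₗ[F] _))
    (fun t ht => (Submodule.Quotient.mk_eq_zero C).mpr (h₁ t (mem_J₂.mpr ht)))
  obtain ⟨μ₂, hμ₂⟩ := exists_comp_eq_of_ker_le (kappa (⊤ : LieIdeal F L₂) : _ →ₗ[F] L₂)
    (C.mkQ ∘ₗ (selfMap (FreeProd.inr F L₁ L₂) : _ →ₗ[F] _))
    (fun t ht => (Submodule.Quotient.mk_eq_zero C).mpr (h₂ t (mem_J₂.mpr ht)))
  obtain ⟨μ, hμ⟩ := FreeProd.exists_primitive hω μ₁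
    (fun x y => by
      have := hμ₁ (selfTmul F x y)
      rwa [LieHom.coe_toLinearMap, kappa_selfTmul, LinearMap.comp_apply, LieHom.coe_toLinearMap,
        selfMap_selfTmul] at this) μ₂
    (fun x y => by
      have := hμ₂ (selfTmul F x y)
      rwa [LieHom.coe_toLinearMap, kappa_selfTmul, LinearMap.comp_apply, LieHom.coe_toLinearMap,
        selfMap_selfTmul] at this)
  -- A primitive on the whole free product makes the projection modulo `C` factor through `κ`, hence
  -- it vanishes on `J₂`.
  have h : C.mkQ = μ ∘ₗ (kappa (⊤ : LieIdeal F (FreeProd F L₁ L₂)) : _ →ₗ[F] _) :=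
    selfTensor_linearMap_ext fun x y => by
      rw [LinearMap.comp_apply, LieHom.coe_toLinearMap, kappa_selfTmul, hμ]
      rfl
  intro t ht
  rw [← Submodule.Quotient.mk_eq_zero, ← Submodule.mkQ_apply, h, LinearMap.comp_apply,
    LieHom.coe_toLinearMap, mem_J₂.mp ht, map_zero]

/-- The elements with such a decomposition form a subalgebra, as every bracket is in the derived
ideal, and both factors belong to it. -/
theorem FreeProd.exists_sub_mem_derived (x : FreeProd F L₁ L₂) :
    ∃ a b, x - (FreeProd.inl F L₁ L₂ a + FreeProd.inr F L₁ L₂ b) ∈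
      derived F (FreeProd F L₁ L₂) := by
  let S : LieSubalgebra F (FreeProd F L₁ L₂) :=
    { carrier := {x | ∃ a b, x - (FreeProd.inl F L₁ L₂ a + FreeProd.inr F L₁ L₂ b) ∈
        derived F (FreeProd F L₁ L₂)}
      add_mem' := by
        rintro x y ⟨a, b, h⟩ ⟨a', b', h'⟩
        refine ⟨a + a', b + b', ?_⟩
        convert add_mem h h' using 1
        rw [map_add, map_add]
        abel
      zero_mem' := ⟨0, 0, by simp⟩
      smul_mem' := by
        rintro c x ⟨a, b, h⟩
        refine ⟨c • a, c • b, ?_⟩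
        rw [map_smul, map_smul, ← smul_add, ← smul_sub]
        exact (derived F (FreeProd F L₁ L₂)).smul_mem c h
      lie_mem' := by
        rintro x y _ _
        exact ⟨0, 0, by simpa using lie_mem_derived x y⟩ }
  have hS : S = ⊤ := FreeProd.subalgebra_eq_top (fun a => ⟨a, 0, by simp⟩)
    (fun b => ⟨0, b, by simp⟩)
  have hx : x ∈ S := by rw [hS]; trivial
  exact hx

theorem selfTmul_self_freeProd (x : FreeProd F L₁ L₂) : ∃ a b, selfTmul F x x =
    selfMap (FreeProd.inl F L₁ L₂) (selfTmul F a a) +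
      selfMap (FreeProd.inr F L₁ L₂) (selfTmul F b b) +
        symTmul F _ (FreeProd.inl F L₁ L₂ a) (FreeProd.inr F L₁ L₂ b) := by
  obtain ⟨a, b, h⟩ := FreeProd.exists_sub_mem_derived x
  refine ⟨a, b, ?_⟩
  rw [selfTmul_self_congr h, selfMap_selfTmul, selfMap_selfTmul, symTmul_apply]
  simp only [map_add, LinearMap.add_apply]
  abel

end FreeProduct

/-! ### The three isomorphisms when both ideals are the whole algebras. -/

section FullIdeals

variable (F : Type u) (L₁ : Type v) (L₂ : Type w) [Field F] [LieRing L₁] [LieAlgebra F L₁]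
  [LieRing L₂] [LieAlgebra F L₂]

/-- The projection of the free product onto the first factor. -/
def FreeProd.fst : FreeProd F L₁ L₂ →ₗ⁅F⁆ L₁ := FreeProd.lift LieHom.id 0

/-- The projection of the free product onto the second factor. -/
def FreeProd.snd : FreeProd F L₁ L₂ →ₗ⁅F⁆ L₂ := FreeProd.lift 0 LieHom.id

variable {F L₁ L₂}

@[simp]
theorem FreeProd.fst_inl (x : L₁) : FreeProd.fst F L₁ L₂ (FreeProd.inl F L₁ L₂ x) = x :=
  FreeProd.lift_inl _ _ _

@[simp]
theorem FreeProd.fst_inr (x : L₂) : FreeProd.fst F L₁ L₂ (FreeProd.inr F L₁ L₂ x) = 0 :=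
  FreeProd.lift_inr _ _ _

@[simp]
theorem FreeProd.snd_inl (x : L₁) : FreeProd.snd F L₁ L₂ (FreeProd.inl F L₁ L₂ x) = 0 :=
  FreeProd.lift_inl _ _ _

@[simp]
theorem FreeProd.snd_inr (x : L₂) : FreeProd.snd F L₁ L₂ (FreeProd.inr F L₁ L₂ x) = x :=
  FreeProd.lift_inr _ _ _

variable (F L₁ L₂)

/-- The tensor product of the abelianizations, acting trivially on each other. -/
abbrev AbTensor : Type _ :=
  NonabTensor
    (0 : Coinv (⊤ : LieIdeal F L₁) →ₗ⁅F⁆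
      LieDerivation F (Coinv (⊤ : LieIdeal F L₂)) (Coinv (⊤ : LieIdeal F L₂)))
    (0 : Coinv (⊤ : LieIdeal F L₂) →ₗ⁅F⁆
      LieDerivation F (Coinv (⊤ : LieIdeal F L₁)) (Coinv (⊤ : LieIdeal F L₁)))

variable {F L₁ L₂}

/-- The map `A₁ ⊗ A₂ → G ⊗ G`, `a ⊗ b ↦ a ⊗ b + b ⊗ a`, for the abelianizations of the factors of
a free product `G`. -/
theorem exists_abTensor_symTmul :
    ∃ Ψ : AbTensor F L₁ L₂ →ₗ⁅F⁆ SelfTensor F (FreeProd F L₁ L₂), ∀ a b,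
      Ψ (tmul 0 0 (abMk F L₁ a) (abMk F L₂ b)) =
        symTmul F _ (FreeProd.inl F L₁ L₂ a) (FreeProd.inr F L₁ L₂ b) := by
  obtain ⟨s₁, hs₁⟩ := exists_abMk_section (F := F) (L := L₁)
  obtain ⟨s₂, hs₂⟩ := exists_abMk_section (F := F) (L := L₂)
  let f := (symTmul F (FreeProd F L₁ L₂)).compl₁₂
    ((FreeProd.inl F L₁ L₂ : L₁ →ₗ[F] FreeProd F L₁ L₂) ∘ₗ s₁)
    ((FreeProd.inr F L₁ L₂ : L₂ →ₗ[F] FreeProd F L₁ L₂) ∘ₗ s₂)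
  have hf : IsLiePairing 0 0 f :=
    { lie_left := fun l l' n => by simp [lie_coinv_eq_zero]
      lie_right := fun l n n' => by rw [lie_coinv_eq_zero]; simp
      lie_lie := fun l l' n n' => by
        simp only [f, LinearMap.compl₁₂_apply, lie_symTmul]
        simp }
  refine ⟨tensorLift f hf, fun a b => ?_⟩
  rw [tensorLift_tmul]
  refine symTmul_congr ?_ ?_
  · rw [LinearMap.comp_apply, LieHom.coe_toLinearMap, ← map_sub]
    exact map_mem_derived _ (hs₁ a)
  · rw [LinearMap.comp_apply, LieHom.coe_toLinearMap, ← map_sub]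
    exact map_mem_derived _ (hs₂ b)

/-- The map `G ⊗ G → A₁ ⊗ A₂` for the abelianizations of the factors of a free product `G`. -/
theorem exists_selfTensor_abTensor :
    ∃ Φ : SelfTensor F (FreeProd F L₁ L₂) →ₗ⁅F⁆ AbTensor F L₁ L₂, ∀ x y,
      Φ (selfTmul F x y) =
        tmul 0 0 (abMk F L₁ (FreeProd.fst F L₁ L₂ x)) (abMk F L₂ (FreeProd.snd F L₁ L₂ y)) := by
  let f : FreeProd F L₁ L₂ →ₗ[F] (⊤ : LieIdeal F (FreeProd F L₁ L₂)) →ₗ[F] AbTensor F L₁ L₂ :=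
    (tmulₗ 0 0).compl₁₂
      ((abMk F L₁).comp (FreeProd.fst F L₁ L₂) : FreeProd F L₁ L₂ →ₗ[F] _)
      (((abMk F L₂).comp (FreeProd.snd F L₁ L₂)).comp (LieIdeal.incl ⊤) :
        (⊤ : LieIdeal F (FreeProd F L₁ L₂)) →ₗ[F] _)
  have hfa (x : FreeProd F L₁ L₂) (y : (⊤ : LieIdeal F (FreeProd F L₁ L₂))) : f x y =
    tmul 0 0 (abMk F L₁ (FreeProd.fst F L₁ L₂ x)) (abMk F L₂ (FreeProd.snd F L₁ L₂ (y : _))) := rfl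
  have hf : IsLiePairing (actOnIdeal ⊤) (idealAct ⊤) f :=
    { lie_left := fun l l' n => by
        simp only [hfa, actOnIdeal_apply_coe, LieHom.map_lie (FreeProd.fst F L₁ L₂),
          LieHom.map_lie (FreeProd.snd F L₁ L₂), abMk_lie, tmul_zero_left, tmul_zero_right,
          sub_zero]
      lie_right := fun l n n' => by
        simp only [hfa, idealAct_apply, LieHom.map_lie (FreeProd.fst F L₁ L₂),
          abMk_lie, tmul_zero_left, sub_zero]
        change tmul 0 0 _ (abMk F L₂ (FreeProd.snd F L₁ L₂ ⁅(n : FreeProd F L₁ L₂), (n' : _)⁆)) = 0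
        rw [LieHom.map_lie, abMk_lie, tmul_zero_right]
      lie_lie := fun l l' n n' => by
        simp only [hfa, lie_tmul_tmul, actOnIdeal_apply_coe,
          LieHom.map_lie (FreeProd.snd F L₁ L₂), abMk_lie, tmul_zero_right]
        simp }
  exact ⟨tensorLift f hf, fun x y => tensorLift_tmul f hf x (toTop F _ y)⟩

theorem selfMap_fst_inl (t : SelfTensor F L₁) :
    selfMap (FreeProd.fst F L₁ L₂) (selfMap (FreeProd.inl F L₁ L₂) t) = t :=
  pairMap_pairMap_eq_self _ _ _ _ FreeProd.fst_inl t

theorem selfMap_snd_inr (t : SelfTensor F L₂) :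
    selfMap (FreeProd.snd F L₁ L₂) (selfMap (FreeProd.inr F L₁ L₂) t) = t :=
  pairMap_pairMap_eq_self _ _ _ _ FreeProd.snd_inr t

theorem selfMap_fst_inr (t : SelfTensor F L₂) :
    selfMap (FreeProd.fst F L₁ L₂) (selfMap (FreeProd.inr F L₁ L₂) t) = 0 :=
  pairMap_pairMap_eq_zero _ _ _ _ FreeProd.fst_inr t

theorem selfMap_snd_inl (t : SelfTensor F L₁) :
    selfMap (FreeProd.snd F L₁ L₂) (selfMap (FreeProd.inl F L₁ L₂) t) = 0 :=
  pairMap_pairMap_eq_zero _ _ _ _ FreeProd.snd_inl t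

theorem abTensor_hom_ext {M : Type*} [LieRing M] [LieAlgebra F M]
    {f g : AbTensor F L₁ L₂ →ₗ⁅F⁆ M}
    (h : ∀ a b, f (tmul 0 0 (abMk F L₁ a) (abMk F L₂ b)) =
      g (tmul 0 0 (abMk F L₁ a) (abMk F L₂ b))) : f = g :=
  LieHom.coe_injective <| congrArg (fun k : AbTensor F L₁ L₂ →ₗ[F] M => (k : _ → M)) <|
    tensor_linearMap_ext (f := (f : AbTensor F L₁ L₂ →ₗ[F] M)) (g := (g : AbTensor F L₁ L₂ →ₗ[F] M))
      fun l n => by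
        obtain ⟨a, rfl⟩ := abMk_surjective l
        obtain ⟨b, rfl⟩ := abMk_surjective n
        exact h a b

theorem selfTensor_hom_ext {L M : Type*} [LieRing L] [LieAlgebra F L] [LieRing M]
    [LieAlgebra F M] {f g : SelfTensor F L →ₗ⁅F⁆ M}
    (h : ∀ x y, f (selfTmul F x y) = g (selfTmul F x y)) : f = g :=
  LieHom.coe_injective <| congrArg (fun k : SelfTensor F L →ₗ[F] M => (k : _ → M)) <|
    selfTensor_linearMap_ext (f := (f : SelfTensor F L →ₗ[F] M))
      (g := (g : SelfTensor F L →ₗ[F] M)) h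

/-- The maps induced by the two projections, together with `Φ`, invert those induced by the two
inclusions, together with `Ψ`, and all cross composites vanish. In `Φ ∘ Ψ` only one of the two terms
of `a ⊗ b + b ⊗ a` survives. It remains that the three images fill `J₂`, which is `hdecomp`. -/
theorem nonempty_J₂_freeProd_equiv :
    Nonempty (J₂ (⊤ : LieIdeal F (FreeProd F L₁ L₂)) ≃ₗ⁅F⁆
      (J₂ (⊤ : LieIdeal F L₁) × J₂ (⊤ : LieIdeal F L₂) × AbTensor F L₁ L₂)) := by
  obtain ⟨Ψ, hΨ⟩ := exists_abTensor_symTmul (F := F) (L₁ := L₁) (L₂ := L₂)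
  obtain ⟨Φ, hΦ⟩ := exists_selfTensor_abTensor (F := F) (L₁ := L₁) (L₂ := L₂)
  have hΨJ (t) : Ψ t ∈ J₂ (⊤ : LieIdeal F (FreeProd F L₁ L₂)) := by
    have : (kappa ⊤).comp Ψ = 0 := abTensor_hom_ext fun a b => by
      rw [LieHom.comp_apply, hΨ, kappa_symTmul, LieHom.zero_apply]
    exact mem_J₂.mpr (LieHom.congr_fun this t)
  have h₁Ψ (t) : selfMap (FreeProd.fst F L₁ L₂) (Ψ t) = 0 := by
    have : (selfMap (FreeProd.fst F L₁ L₂)).comp Ψ = 0 := abTensor_hom_ext fun a b => by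
      simp [hΨ, selfMap_symTmul]
    exact LieHom.congr_fun this t
  have h₂Ψ (t) : selfMap (FreeProd.snd F L₁ L₂) (Ψ t) = 0 := by
    have : (selfMap (FreeProd.snd F L₁ L₂)).comp Ψ = 0 := abTensor_hom_ext fun a b => by
      simp [hΨ, selfMap_symTmul]
    exact LieHom.congr_fun this t
  have hΦΨ (t) : Φ (Ψ t) = t := by
    have : Φ.comp Ψ = LieHom.id := abTensor_hom_ext fun a b => by
      simp [hΨ, symTmul_apply, hΦ]
    exact LieHom.congr_fun this t
  have hΦ₁ (t) : Φ (selfMap (FreeProd.inl F L₁ L₂) t) = 0 := by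
    have : Φ.comp (selfMap (FreeProd.inl F L₁ L₂)) = 0 := selfTensor_hom_ext fun a b => by
      simp [hΦ]
    exact LieHom.congr_fun this t
  have hΦ₂ (t) : Φ (selfMap (FreeProd.inr F L₁ L₂) t) = 0 := by
    have : Φ.comp (selfMap (FreeProd.inr F L₁ L₂)) = 0 := selfTensor_hom_ext fun a b => by
      simp [hΦ]
    exact LieHom.congr_fun this t
  have hdecomp : ∀ t ∈ J₂ (⊤ : LieIdeal F (FreeProd F L₁ L₂)),
      ∃ t₁ ∈ J₂ (⊤ : LieIdeal F L₁), ∃ t₂ ∈ J₂ (⊤ : LieIdeal F L₂), ∃ t₃,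
        t = selfMap (FreeProd.inl F L₁ L₂) t₁ + selfMap (FreeProd.inr F L₁ L₂) t₂ + Ψ t₃ := by
    let C : Submodule F (SelfTensor F (FreeProd F L₁ L₂)) :=
      (J₂ (⊤ : LieIdeal F L₁)).toSubmodule.map (selfMap (FreeProd.inl F L₁ L₂) : _ →ₗ[F] _) ⊔
        (J₂ (⊤ : LieIdeal F L₂)).toSubmodule.map (selfMap (FreeProd.inr F L₁ L₂) : _ →ₗ[F] _) ⊔
          LinearMap.range (Ψ : AbTensor F L₁ L₂ →ₗ[F] _)
    have h₁ : ∀ t ∈ J₂ (⊤ : LieIdeal F L₁), selfMap (FreeProd.inl F L₁ L₂) t ∈ C := fun t ht =>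
      Submodule.mem_sup_left (Submodule.mem_sup_left ⟨t, ht, rfl⟩)
    have h₂ : ∀ t ∈ J₂ (⊤ : LieIdeal F L₂), selfMap (FreeProd.inr F L₁ L₂) t ∈ C := fun t ht =>
      Submodule.mem_sup_left (Submodule.mem_sup_right ⟨t, ht, rfl⟩)
    -- Each `x ⊗ x` splits into diagonal elements of the factors, which lie in their `J₂`, and a
    -- mixed term in the range of `Ψ`.
    have hC := J₂_freeProd_le C (fun x => by
      obtain ⟨a, b, h⟩ := selfTmul_self_freeProd x
      rw [h, ← hΨ]
      exact add_mem (add_mem (h₁ _ (selfTmul_self_mem_J₂ a)) (h₂ _ (selfTmul_self_mem_J₂ b)))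
        (Submodule.mem_sup_right ⟨_, rfl⟩)) h₁ h₂
    intro t ht
    obtain ⟨_, hy, _, ⟨t₃, rfl⟩, rfl⟩ := Submodule.mem_sup.mp (hC ht)
    obtain ⟨_, ⟨t₁, ht₁, rfl⟩, _, ⟨t₂, ht₂, rfl⟩, rfl⟩ := Submodule.mem_sup.mp hy
    exact ⟨t₁, ht₁, t₂, ht₂, t₃, rfl⟩
  let Θ : J₂ (⊤ : LieIdeal F (FreeProd F L₁ L₂)) →ₗ⁅F⁆
      (J₂ (⊤ : LieIdeal F L₁) × J₂ (⊤ : LieIdeal F L₂) × AbTensor F L₁ L₂) :=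
    LieHom.prod (restrictIdeal (selfMap (FreeProd.fst F L₁ L₂)) _ _ fun _ => pairMap_mem_J₂ _ _)
      (LieHom.prod (restrictIdeal (selfMap (FreeProd.snd F L₁ L₂)) _ _ fun _ => pairMap_mem_J₂ _ _)
        (Φ.comp (LieIdeal.incl _)))
  refine ⟨LieEquiv.ofBijective Θ ⟨(injective_iff_map_eq_zero Θ).mpr ?_, ?_⟩⟩
  · rintro ⟨t, ht⟩ h
    have e₁ : selfMap (FreeProd.fst F L₁ L₂) t = 0 := congrArg (fun p => (p.1 : SelfTensor F L₁)) h
    have e₂ : selfMap (FreeProd.snd F L₁ L₂) t = 0 :=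
      congrArg (fun p => (p.2.1 : SelfTensor F L₂)) h
    have e₃ : Φ t = 0 := congrArg (fun p => p.2.2) h
    obtain ⟨t₁, ht₁, t₂, ht₂, t₃, rfl⟩ := hdecomp t ht
    rw [map_add, map_add, selfMap_fst_inl, selfMap_fst_inr, h₁Ψ, add_zero, add_zero] at e₁
    rw [map_add, map_add, selfMap_snd_inl, selfMap_snd_inr, h₂Ψ, add_zero, zero_add] at e₂
    rw [map_add, map_add, hΦ₁, hΦ₂, hΦΨ, add_zero, zero_add] at e₃
    refine Subtype.ext ?_
    simp [e₁, e₂, e₃]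
  · rintro ⟨⟨t₁, ht₁⟩, ⟨t₂, ht₂⟩, t₃⟩
    refine ⟨⟨selfMap (FreeProd.inl F L₁ L₂) t₁ + selfMap (FreeProd.inr F L₁ L₂) t₂ + Ψ t₃,
      add_mem (add_mem (pairMap_mem_J₂ _ _ ht₁) (pairMap_mem_J₂ _ _ ht₂)) (hΨJ t₃)⟩, ?_⟩
    refine Prod.ext (Subtype.ext ?_) (Prod.ext (Subtype.ext ?_) ?_)
    · change selfMap (FreeProd.fst F L₁ L₂) (_ + _ + _) = t₁
      rw [map_add, map_add, selfMap_fst_inl, selfMap_fst_inr, h₁Ψ, add_zero, add_zero]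
    · change selfMap (FreeProd.snd F L₁ L₂) (_ + _ + _) = t₂
      rw [map_add, map_add, selfMap_snd_inl, selfMap_snd_inr, h₂Ψ, add_zero, zero_add]
    · change Φ (_ + _ + _) = t₃
      rw [map_add, map_add, hΦ₁, hΦ₂, hΦΨ, add_zero, zero_add]

/-- The map of exterior squares induced by a morphism. -/
def selfExtMap {L : Type*} {L' : Type*} [LieRing L] [LieAlgebra F L] [LieRing L']
    [LieAlgebra F L'] (f : L →ₗ⁅F⁆ L') :
    PairExterior (⊤ : LieIdeal F L) →ₗ⁅F⁆ PairExterior (⊤ : LieIdeal F L') :=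
  pairExtMap f fun _ _ => LieSubmodule.mem_top _

/-- The argument is that for `J₂`, with the whole diagonal as the third piece of `C`. This piece
vanishes in the exterior square, so only the two factors contribute. -/
theorem nonempty_schurMultiplier_freeProd_equiv :
    Nonempty (schurMultiplier (⊤ : LieIdeal F (FreeProd F L₁ L₂)) ≃ₗ⁅F⁆
      (schurMultiplier (⊤ : LieIdeal F L₁) × schurMultiplier (⊤ : LieIdeal F L₂))) := by
  have h₁₁ (t) : selfExtMap (FreeProd.fst F L₁ L₂) (selfExtMap (FreeProd.inl F L₁ L₂) t) = t :=
    pairExtMap_pairExtMap_eq_self _ _ _ _ FreeProd.fst_inl t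
  have h₂₂ (t) : selfExtMap (FreeProd.snd F L₁ L₂) (selfExtMap (FreeProd.inr F L₁ L₂) t) = t :=
    pairExtMap_pairExtMap_eq_self _ _ _ _ FreeProd.snd_inr t
  have h₁₂ (t) : selfExtMap (FreeProd.fst F L₁ L₂) (selfExtMap (FreeProd.inr F L₁ L₂) t) = 0 :=
    pairExtMap_pairExtMap_eq_zero _ _ _ _ FreeProd.fst_inr t
  have h₂₁ (t) : selfExtMap (FreeProd.snd F L₁ L₂) (selfExtMap (FreeProd.inl F L₁ L₂) t) = 0 :=
    pairExtMap_pairExtMap_eq_zero _ _ _ _ FreeProd.snd_inl t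
  have hdecomp : ∀ t ∈ schurMultiplier (⊤ : LieIdeal F (FreeProd F L₁ L₂)),
      ∃ t₁ t₂, t = selfExtMap (FreeProd.inl F L₁ L₂) t₁ + selfExtMap (FreeProd.inr F L₁ L₂) t₂ := by
    let C : Submodule F (SelfTensor F (FreeProd F L₁ L₂)) :=
      (J₂ (⊤ : LieIdeal F L₁)).toSubmodule.map (selfMap (FreeProd.inl F L₁ L₂) : _ →ₗ[F] _) ⊔
        (J₂ (⊤ : LieIdeal F L₂)).toSubmodule.map (selfMap (FreeProd.inr F L₁ L₂) : _ →ₗ[F] _) ⊔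
          (diagonal (⊤ : LieIdeal F (FreeProd F L₁ L₂))).toSubmodule
    have hC := J₂_freeProd_le C
      (fun x => Submodule.mem_sup_right (selfTmul_self_mem_diagonal x))
      (fun t ht => Submodule.mem_sup_left (Submodule.mem_sup_left ⟨t, ht, rfl⟩))
      (fun t ht => Submodule.mem_sup_left (Submodule.mem_sup_right ⟨t, ht, rfl⟩))
    intro t ht
    obtain ⟨t, rfl⟩ := quotMk_surjective _ t
    have ht' : t ∈ J₂ (⊤ : LieIdeal F (FreeProd F L₁ L₂)) := mem_J₂.mpr (mem_schurMultiplier.mp ht)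
    obtain ⟨_, hy, d, hd, rfl⟩ := Submodule.mem_sup.mp (hC ht')
    obtain ⟨_, ⟨t₁, ht₁, rfl⟩, _, ⟨t₂, ht₂, rfl⟩, rfl⟩ := Submodule.mem_sup.mp hy
    refine ⟨quotMk _ t₁, quotMk _ t₂, ?_⟩
    rw [map_add, map_add, quotMk_eq_zero.mpr hd, add_zero]
    rfl
  let Θ : schurMultiplier (⊤ : LieIdeal F (FreeProd F L₁ L₂)) →ₗ⁅F⁆
      (schurMultiplier (⊤ : LieIdeal F L₁) × schurMultiplier (⊤ : LieIdeal F L₂)) :=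
    LieHom.prod (restrictIdeal (selfExtMap (FreeProd.fst F L₁ L₂)) _ _
        fun _ => pairExtMap_mem_schurMultiplier _ _)
      (restrictIdeal (selfExtMap (FreeProd.snd F L₁ L₂)) _ _
        fun _ => pairExtMap_mem_schurMultiplier _ _)
  refine ⟨LieEquiv.ofBijective Θ ⟨(injective_iff_map_eq_zero Θ).mpr ?_, ?_⟩⟩
  · rintro ⟨t, ht⟩ h
    have e₁ : selfExtMap (FreeProd.fst F L₁ L₂) t = 0 :=
      congrArg (fun p => (p.1 : PairExterior (⊤ : LieIdeal F L₁))) h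
    have e₂ : selfExtMap (FreeProd.snd F L₁ L₂) t = 0 :=
      congrArg (fun p => (p.2 : PairExterior (⊤ : LieIdeal F L₂))) h
    obtain ⟨t₁, t₂, rfl⟩ := hdecomp t ht
    rw [map_add, h₁₁, h₁₂, add_zero] at e₁
    rw [map_add, h₂₁, h₂₂, zero_add] at e₂
    refine Subtype.ext ?_
    simp [e₁, e₂]
  · rintro ⟨⟨t₁, ht₁⟩, ⟨t₂, ht₂⟩⟩
    refine ⟨⟨selfExtMap (FreeProd.inl F L₁ L₂) t₁ + selfExtMap (FreeProd.inr F L₁ L₂) t₂,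
      add_mem (pairExtMap_mem_schurMultiplier _ _ ht₁) (pairExtMap_mem_schurMultiplier _ _ ht₂)⟩,
      ?_⟩
    refine Prod.ext (Subtype.ext ?_) (Subtype.ext ?_)
    · change selfExtMap (FreeProd.fst F L₁ L₂) (_ + _) = t₁
      rw [map_add, h₁₁, h₁₂, add_zero]
    · change selfExtMap (FreeProd.snd F L₁ L₂) (_ + _) = t₂
      rw [map_add, h₂₁, h₂₂, zero_add]

/-- The projection `π` identifies the abelianizations of the free product and the direct sum, and `x
⊗ x` depends only on the class of `x` there. Injectivity needs only a linear left inverse on the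
diagonal, not a morphism of Lie algebras. -/
theorem nonempty_diagonal_freeProd_equiv :
    Nonempty (diagonal (⊤ : LieIdeal F (FreeProd F L₁ L₂)) ≃ₗ⁅F⁆
      diagonal (⊤ : LieIdeal F (L₁ × L₂))) := by
  let π : FreeProd F L₁ L₂ →ₗ⁅F⁆ L₁ × L₂ :=
    LieHom.prod (FreeProd.fst F L₁ L₂) (FreeProd.snd F L₁ L₂)
  let j : L₁ × L₂ →ₗ[F] FreeProd F L₁ L₂ :=
    LinearMap.coprod (FreeProd.inl F L₁ L₂ : L₁ →ₗ[F] _) (FreeProd.inr F L₁ L₂ : L₂ →ₗ[F] _)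
  have hj (p : L₁ × L₂) : j p = FreeProd.inl F L₁ L₂ p.1 + FreeProd.inr F L₁ L₂ p.2 := rfl
  have hπj (p) : π (j p) = p := by
    have h₁ : FreeProd.fst F L₁ L₂ (j p) = p.1 := by simp [hj]
    have h₂ : FreeProd.snd F L₁ L₂ (j p) = p.2 := by simp [hj]
    exact Prod.ext h₁ h₂
  have hj' {p : L₁ × L₂} (hp : p ∈ derived F (L₁ × L₂)) :
      j p ∈ derived F (FreeProd F L₁ L₂) :=
    add_mem (map_mem_derived ((FreeProd.inl F L₁ L₂).comp (LieHom.fst F L₁ L₂)) hp)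
      (map_mem_derived ((FreeProd.inr F L₁ L₂).comp (LieHom.snd F L₁ L₂)) hp)
  have hjπ (x) : j (π x) - x ∈ derived F (FreeProd F L₁ L₂) := by
    obtain ⟨a, b, h⟩ := FreeProd.exists_sub_mem_derived x
    obtain ⟨c, hc, rfl⟩ : ∃ c ∈ derived F (FreeProd F L₁ L₂), x = j (a, b) + c :=
      ⟨_, h, by rw [hj]; abel⟩
    rw [map_add, map_add, hπj, add_sub_add_left_eq_sub]
    exact sub_mem (hj' (map_mem_derived π hc)) hc
  obtain ⟨s, hs⟩ := exists_abMk_section (F := F) (L := L₁ × L₂)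
  -- The linear section `j` does not respect brackets. Replacing it by `r`, which passes through the
  -- abelianization, makes `(p, q) ↦ r p ⊗ r q` kill commutators and so extend to the tensor square,
  -- while `r` and `j` agree modulo the derived ideal.
  let r : L₁ × L₂ →ₗ[F] FreeProd F L₁ L₂ :=
    j ∘ₗ s ∘ₗ (abMk F (L₁ × L₂) : L₁ × L₂ →ₗ[F] Coinv (⊤ : LieIdeal F (L₁ × L₂)))
  have hr (p) : r p - j p ∈ derived F (FreeProd F L₁ L₂) := by
    have := hj' (hs p)
    rwa [map_sub] at this
  have hr₀ (p q : L₁ × L₂) : r ⁅p, q⁆ = 0 := by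
    simp only [r, LinearMap.comp_apply, LieHom.coe_toLinearMap, abMk_lie, map_zero]
  obtain ⟨e, he⟩ := exists_linearMap_selfTmul ((selfTmul F).compl₁₂ r r)
    (fun x y z => by rw [LinearMap.compl₁₂_apply, hr₀, map_zero, LinearMap.zero_apply])
    (fun x y z => by rw [LinearMap.compl₁₂_apply, hr₀, map_zero])
  have heπ : ∀ t ∈ diagonal (⊤ : LieIdeal F (FreeProd F L₁ L₂)), e (selfMap π t) = t := by
    intro t ht
    rw [← LieSubmodule.mem_toSubmodule, diagonal_top_eq_span] at ht
    refine Submodule.span_induction (p := fun t _ => e (selfMap π t) = t) ?_ (by simp)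
      (fun x y _ _ hx hy => by rw [map_add, map_add, hx, hy])
      (fun c x _ hx => by rw [map_smul, map_smul, hx]) ht
    rintro _ ⟨x, rfl⟩
    simp only [selfMap_selfTmul, he, LinearMap.compl₁₂_apply]
    refine selfTmul_self_congr ?_
    have := add_mem (hr (π x)) (hjπ x)
    rwa [sub_add_sub_cancel] at this
  refine ⟨LieEquiv.ofBijective (restrictIdeal (selfMap π) _ _ fun _ => pairMap_mem_diagonal _ _)
    ⟨fun x y hxy => Subtype.ext ?_, ?_⟩⟩
  · rw [← heπ x x.2, ← heπ y y.2]
    exact congrArg e (congrArg Subtype.val hxy)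
  · rintro ⟨t, ht⟩
    have hle : (diagonal (⊤ : LieIdeal F (L₁ × L₂))).toSubmodule ≤
        (diagonal (⊤ : LieIdeal F (FreeProd F L₁ L₂))).toSubmodule.map
          (selfMap π : _ →ₗ[F] _) := by
      rw [diagonal_top_eq_span, Submodule.span_le]
      rintro _ ⟨p, rfl⟩
      refine ⟨selfTmul F (j p) (j p), selfTmul_self_mem_diagonal _, ?_⟩
      rw [LieHom.coe_toLinearMap, selfMap_selfTmul, hπj]
    obtain ⟨t', ht', h⟩ := hle ht
    exact ⟨⟨t', ht'⟩, Subtype.ext h⟩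

end FullIdeals

/-! ### Zero factors, zero ideals and full ideals. -/

section Degenerate

variable {F L₁ L₂ : Type*} [Field F] [LieRing L₁] [LieAlgebra F L₁] [LieRing L₂] [LieAlgebra F L₂]
  {N₁ : LieIdeal F L₁} {N₂ : LieIdeal F L₂} {N : LieIdeal F (FreeProd F L₁ L₂)}

theorem fst_mem (hN : N.toLieSubalgebra = freeProdSubalgebra N₁ N₂) {x : FreeProd F L₁ L₂}
    (hx : x ∈ N) : FreeProd.fst F L₁ L₂ x ∈ N₁ := by
  replace hx : x ∈ N.toLieSubalgebra := hx
  rw [hN] at hx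
  obtain ⟨t, rfl⟩ := hx
  have : (FreeProd.fst F L₁ L₂).comp (FreeProd.lift ((FreeProd.inl F L₁ L₂).comp N₁.incl)
      ((FreeProd.inr F L₁ L₂).comp N₂.incl)) = N₁.incl.comp (FreeProd.fst F N₁ N₂) :=
    FreeProd.hom_ext (fun a => by simp [FreeProd.lift_inl]) (fun a => by simp [FreeProd.lift_inr])
  have h := LieHom.congr_fun this t
  rw [LieHom.comp_apply] at h
  exact h ▸ (FreeProd.fst F N₁ N₂ t).2

theorem snd_mem (hN : N.toLieSubalgebra = freeProdSubalgebra N₁ N₂) {x : FreeProd F L₁ L₂}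
    (hx : x ∈ N) : FreeProd.snd F L₁ L₂ x ∈ N₂ := by
  replace hx : x ∈ N.toLieSubalgebra := hx
  rw [hN] at hx
  obtain ⟨t, rfl⟩ := hx
  have : (FreeProd.snd F L₁ L₂).comp (FreeProd.lift ((FreeProd.inl F L₁ L₂).comp N₁.incl)
      ((FreeProd.inr F L₁ L₂).comp N₂.incl)) = N₂.incl.comp (FreeProd.snd F N₁ N₂) :=
    FreeProd.hom_ext (fun a => by simp [FreeProd.lift_inl]) (fun a => by simp [FreeProd.lift_inr])
  have h := LieHom.congr_fun this t
  rw [LieHom.comp_apply] at h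
  exact h ▸ (FreeProd.snd F N₁ N₂ t).2

theorem inr_snd [Subsingleton L₁] (x : FreeProd F L₁ L₂) :
    FreeProd.inr F L₁ L₂ (FreeProd.snd F L₁ L₂ x) = x := by
  have : (FreeProd.inr F L₁ L₂).comp (FreeProd.snd F L₁ L₂) = LieHom.id :=
    FreeProd.hom_ext (fun a => by simp [Subsingleton.elim a 0]) (fun a => by simp)
  exact LieHom.congr_fun this x

theorem inl_fst [Subsingleton L₂] (x : FreeProd F L₁ L₂) :
    FreeProd.inl F L₁ L₂ (FreeProd.fst F L₁ L₂ x) = x := by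
  have : (FreeProd.inl F L₁ L₂).comp (FreeProd.fst F L₁ L₂) = LieHom.id :=
    FreeProd.hom_ext (fun a => by simp) (fun a => by simp [Subsingleton.elim a 0])
  exact LieHom.congr_fun this x

theorem subsingleton_of_bot (hN : N.toLieSubalgebra = freeProdSubalgebra N₁ N₂) (h₁ : N₁ = ⊥)
    (h₂ : N₂ = ⊥) : Subsingleton N := by
  subst h₁ h₂
  have hz : (FreeProd.lift ((FreeProd.inl F L₁ L₂).comp (LieIdeal.incl (⊥ : LieIdeal F L₁)))
      ((FreeProd.inr F L₁ L₂).comp (LieIdeal.incl (⊥ : LieIdeal F L₂)))) = 0 :=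
    FreeProd.hom_ext
      (fun a => by rw [Subsingleton.elim a 0, map_zero, map_zero, LieHom.zero_apply])
      (fun a => by rw [Subsingleton.elim a 0, map_zero, map_zero, LieHom.zero_apply])
  refine subsingleton_of_forall_eq 0 fun x => Subtype.ext ?_
  have hx : (x : FreeProd F L₁ L₂) ∈ N.toLieSubalgebra := x.2
  rw [hN] at hx
  obtain ⟨t, ht⟩ := hx
  rw [← ht]
  exact LieHom.congr_fun hz t

theorem eq_top_of_freeProdSubalgebra (hN : N.toLieSubalgebra = freeProdSubalgebra N₁ N₂)
    (h₁ : N₁ = ⊤) (h₂ : N₂ = ⊤) : N = ⊤ := by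
  subst h₁ h₂
  have h : N.toLieSubalgebra = ⊤ := FreeProd.subalgebra_eq_top
    (fun x => inl_mem hN (LieSubmodule.mem_top x)) (fun x => inr_mem hN (LieSubmodule.mem_top x))
  refine eq_top_iff.mpr fun x _ => ?_
  change x ∈ N.toLieSubalgebra
  rw [h]
  trivial

theorem prodIdeal_top : prodIdeal (⊤ : LieIdeal F L₁) (⊤ : LieIdeal F L₂) = ⊤ :=
  eq_top_iff.mpr fun x _ => (mem_prodIdeal _ _ x).mpr
    ⟨LieSubmodule.mem_top _, LieSubmodule.mem_top _⟩

end Degenerate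

end LiePair

end

/-! ### Case analysis for the theorem. -/

open LiePair in
theorem mainTheorem4 {F : Type*} [Field F]
    {L₁ : Type*} [LieRing L₁] [LieAlgebra F L₁] [FiniteDimensional F L₁]
    {L₂ : Type*} [LieRing L₂] [LieAlgebra F L₂] [FiniteDimensional F L₂]
    (N₁ : LieIdeal F L₁) (N₂ : LieIdeal F L₂)
    -- `(L₁ * L₂, N₁ * N₂)` is a pair: `N` is an ideal of `L₁ * L₂`, and it is `N₁ * N₂`
    (N : LieIdeal F (FreeProd F L₁ L₂))
    (hN : N.toLieSubalgebra = freeProdSubalgebra N₁ N₂) :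
    Nonempty (J₂ N ≃ₗ⁅F⁆
      (J₂ N₁ × J₂ N₂ ×
        NonabTensor (0 : Coinv N₁ →ₗ⁅F⁆ LieDerivation F (Coinv N₂) (Coinv N₂))
          (0 : Coinv N₂ →ₗ⁅F⁆ LieDerivation F (Coinv N₁) (Coinv N₁)))) ∧
    Nonempty (diagonal N ≃ₗ⁅F⁆ diagonal (prodIdeal N₁ N₂)) ∧
    ((∃ K : LieSubalgebra F L₁, IsCompl K.toSubmodule N₁.toSubmodule) →
      ⁅N₁, (⊤ : LieIdeal F L₁)⁆ = ⁅(⊤ : LieIdeal F L₁), (⊤ : LieIdeal F L₁)⁆ →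
      Nonempty (schurMultiplier N ≃ₗ⁅F⁆ (schurMultiplier N₁ × schurMultiplier N₂))) := by
  have hbot₁ (h : N₁ = ⊥) : Subsingleton N₁ := by subst h; infer_instance
  have hbot₂ (h : N₂ = ⊥) : Subsingleton N₂ := by subst h; infer_instance
  -- A zero factor is set apart: then `N₁` is at once zero and everything, and `N₂` may be any
  -- ideal. The free product collapses to the other factor and the pair becomes `(L₂, N₂)`.
  rcases subsingleton_or_nontrivial L₁ with h₁ | h₁
  · have := subsingleton_J₂ (N := N₁)
    have := subsingleton_coinv (N := N₁)
    have := subsingleton_schurMultiplier (N := N₁)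
    have : Subsingleton (NonabTensor (0 : Coinv N₁ →ₗ⁅F⁆ LieDerivation F (Coinv N₂) (Coinv N₂))
      (0 : Coinv N₂ →ₗ⁅F⁆ LieDerivation F (Coinv N₁) (Coinv N₁))) := subsingleton_tensor_of_left
    refine ⟨?_, ?_, fun _ _ => ?_⟩
    · obtain ⟨e₁⟩ := nonempty_J₂_equiv (FreeProd.snd F L₁ L₂) (FreeProd.inr F L₁ L₂)
        (fun _ => snd_mem hN) (fun _ => inr_mem hN) inr_snd FreeProd.snd_inr
      obtain ⟨e₂⟩ := nonempty_fst_equiv (F := F) (A := J₂ N₂)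
        (B := NonabTensor (0 : Coinv N₁ →ₗ⁅F⁆ LieDerivation F (Coinv N₂) (Coinv N₂))
          (0 : Coinv N₂ →ₗ⁅F⁆ LieDerivation F (Coinv N₁) (Coinv N₁)))
      obtain ⟨e₃⟩ := nonempty_snd_equiv (F := F) (A := J₂ N₁) (B := J₂ N₂ ×
        NonabTensor (0 : Coinv N₁ →ₗ⁅F⁆ LieDerivation F (Coinv N₂) (Coinv N₂))
          (0 : Coinv N₂ →ₗ⁅F⁆ LieDerivation F (Coinv N₁) (Coinv N₁)))
      exact ⟨e₁.trans (e₂.symm.trans e₃.symm)⟩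
    · exact nonempty_diagonal_equiv ((LieHom.inr F L₁ L₂).comp (FreeProd.snd F L₁ L₂))
        ((FreeProd.inr F L₁ L₂).comp (LieHom.snd F L₁ L₂))
        (fun x hx => (mem_prodIdeal _ _ _).mpr ⟨zero_mem _, snd_mem hN hx⟩)
        (fun x hx => inr_mem hN ((mem_prodIdeal _ _ _).mp hx).2) (fun x => inr_snd x)
        (fun x => Prod.ext (Subsingleton.elim _ _) (FreeProd.snd_inr x.2))
    · obtain ⟨e₁⟩ := nonempty_schurMultiplier_equiv (FreeProd.snd F L₁ L₂) (FreeProd.inr F L₁ L₂)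
        (fun _ => snd_mem hN) (fun _ => inr_mem hN) inr_snd FreeProd.snd_inr
      obtain ⟨e₂⟩ := nonempty_snd_equiv (F := F) (A := schurMultiplier N₁)
        (B := schurMultiplier N₂)
      exact ⟨e₁.trans e₂.symm⟩
  rcases subsingleton_or_nontrivial L₂ with h₂ | h₂
  · have := subsingleton_J₂ (N := N₂)
    have := subsingleton_coinv (N := N₂)
    have := subsingleton_schurMultiplier (N := N₂)
    have : Subsingleton (NonabTensor (0 : Coinv N₁ →ₗ⁅F⁆ LieDerivation F (Coinv N₂) (Coinv N₂))
      (0 : Coinv N₂ →ₗ⁅F⁆ LieDerivation F (Coinv N₁) (Coinv N₁))) := subsingleton_tensor_of_right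
    refine ⟨?_, ?_, fun _ _ => ?_⟩
    · obtain ⟨e₁⟩ := nonempty_J₂_equiv (FreeProd.fst F L₁ L₂) (FreeProd.inl F L₁ L₂)
        (fun _ => fst_mem hN) (fun _ => inl_mem hN) inl_fst FreeProd.fst_inl
      obtain ⟨e₂⟩ := nonempty_fst_equiv (F := F) (A := J₂ N₁) (B := J₂ N₂ ×
        NonabTensor (0 : Coinv N₁ →ₗ⁅F⁆ LieDerivation F (Coinv N₂) (Coinv N₂))
          (0 : Coinv N₂ →ₗ⁅F⁆ LieDerivation F (Coinv N₁) (Coinv N₁)))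
      exact ⟨e₁.trans e₂.symm⟩
    · exact nonempty_diagonal_equiv ((LieHom.inl F L₁ L₂).comp (FreeProd.fst F L₁ L₂))
        ((FreeProd.inl F L₁ L₂).comp (LieHom.fst F L₁ L₂))
        (fun x hx => (mem_prodIdeal _ _ _).mpr ⟨fst_mem hN hx, zero_mem _⟩)
        (fun x hx => inl_mem hN ((mem_prodIdeal _ _ _).mp hx).1) (fun x => inl_fst x)
        (fun x => Prod.ext (FreeProd.fst_inl x.1) (Subsingleton.elim _ _))
    · obtain ⟨e₁⟩ := nonempty_schurMultiplier_equiv (FreeProd.fst F L₁ L₂) (FreeProd.inl F L₁ L₂)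
        (fun _ => fst_mem hN) (fun _ => inl_mem hN) inl_fst FreeProd.fst_inl
      obtain ⟨e₂⟩ := nonempty_fst_equiv (F := F) (A := schurMultiplier N₁)
        (B := schurMultiplier N₂)
      exact ⟨e₁.trans e₂.symm⟩
  -- With both factors nonzero, `⊥` and `⊤` differ in each. One nonzero ideal then forces both
  -- ideals to be full, so otherwise both are zero and every algebra in sight vanishes.
  by_cases hN₁ : N₁ = ⊥
  · have hN₂ : N₂ = ⊥ := by
      by_contra h
      exact bot_ne_top (hN₁.symm.trans (eq_top_left_of_freeProdSubalgebra hN h))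
    have := hbot₁ hN₁
    have := hbot₂ hN₂
    have := subsingleton_of_bot hN hN₁ hN₂
    have : Subsingleton (prodIdeal N₁ N₂) := subsingleton_of_forall_eq 0 fun x => by
      have hx := (mem_prodIdeal _ _ _).mp x.2
      exact Subtype.ext (Prod.ext
        (congrArg Subtype.val (Subsingleton.elim ⟨_, hx.1⟩ (0 : N₁)))
        (congrArg Subtype.val (Subsingleton.elim ⟨_, hx.2⟩ (0 : N₂))))
    have := subsingleton_coinv (N := N₁)
    have := subsingleton_J₂ (N := N)
    have := subsingleton_J₂ (N := N₁)
    have := subsingleton_J₂ (N := N₂)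
    have := subsingleton_diagonal (N := N)
    have := subsingleton_diagonal (N := prodIdeal N₁ N₂)
    have := subsingleton_schurMultiplier (N := N)
    have := subsingleton_schurMultiplier (N := N₁)
    have := subsingleton_schurMultiplier (N := N₂)
    have : Subsingleton (NonabTensor (0 : Coinv N₁ →ₗ⁅F⁆ LieDerivation F (Coinv N₂) (Coinv N₂))
      (0 : Coinv N₂ →ₗ⁅F⁆ LieDerivation F (Coinv N₁) (Coinv N₁))) := subsingleton_tensor_of_left
    exact ⟨nonempty_equiv_of_subsingleton, nonempty_equiv_of_subsingleton,
      fun _ _ => nonempty_equiv_of_subsingleton⟩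
  · have hN₂ := eq_top_right_of_freeProdSubalgebra hN hN₁
    have hN₁' := eq_top_left_of_freeProdSubalgebra hN (by rw [hN₂]; exact top_ne_bot)
    obtain rfl := eq_top_of_freeProdSubalgebra hN hN₁' hN₂
    subst hN₁' hN₂
    refine ⟨nonempty_J₂_freeProd_equiv, ?_, fun _ _ => nonempty_schurMultiplier_freeProd_equiv⟩
    rw [prodIdeal_top]
    exact nonempty_diagonal_freeProd_equiv
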